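/- Setting. Manifolds, maps, vector fields and functions are smooth. Let $\pi:Y\to X$ be a fiber bundle with $\dim X=n$ and standard fiber $F$ of dimension $k$. Let $V(T_yY)=\ker d\pi_y$. The vertically adapted frame bundle $L_VY$ is the manifold of pairs $w=(y,\{e_i,\epsilon_A\})$ such that $\{e_i,\epsilon_A\}$ is a frame of $T_yY$ and $\{\epsilon_A\}_{A=1}^{k}$ is a frame of $V(T_yY)$. Such a point is also regarded as a linear isomorphism $w:\mathbb R^{n+k}=\mathbb R^n\times\mathbb R^k\to T_yY$. The group $G_A$ of block matrices $g=\begin{pmatrix}N&0\\A&K\end{pmatrix}$, with $N\in GL(n)$, $K\in GL(k)$ and $A\in\mathbb R^{k\times n}$, acts on $L_VY$ on the right by $w\cdot g=w\circ g$. Let $i^*\theta$ be the $\mathbb R^{n+k}$-valued soldering form on $L_VY$, that is, $(i^*\theta)_w(Z)=w^{-1}(d\pi_{L_VY\to Y}Z)$. Observables. $HF^1(L_VY)$ is the space of functions $f:L_VY\to\mathbb R^{n+k}$ with $df=-Z\lrcorner\, d(i^*\theta)$ for some vector field $Z$ on $L_VY$. $T^1(L_VY)$ is the space of tensorial functions $f:L_VY\to\mathbb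 R^{n+k}$, that is, $f(w\cdot g)=g^{-1}f(w)$ for all $g\in G_A$. Put $T^1_V(L_VY)=HF^1(L_VY)\cap T^1(L_VY)$. Symmetries. $\mathrm{Aut}\,Y$ is the group of diffeomorphisms $\eta$ of $Y$ that cover a diffeomorphism of $X$. It acts on $L_VY$ by $\eta_{L_VY}(w)=\eta_*\circ w$, and it acts on projectable vector fields (those on $Y$ that are $\pi$-related to a vector field on $X$) by $\mathrm{Ad}_\eta\xi=\eta_*\xi$. For $\xi$ projectable, the natural lift $\xi_{L_VY}$ is the vector field on $L_VY$ whose value at $w$ is $\frac{d}{dt}\big|_{t=0}(\psi_{t*}\circ w)$. Here $\psi_t$ is the local flow of $\xi$ or, equivalently, any smooth one-parameter family of local bundle automorphisms of $Y$ near the base point of $w$ with $\psi_0=\mathrm{id}$ and $\frac{d}{dt}\big|_{t=0}\psi_t=\xi$. Lemma. 1. For every projectable vector field $\xi$, the natural lift $\xi_{L_VY}$ exists and is unique, and $$\hat J(\xi):=\xi_{L_VY}\lrcorner\, i^*\theta\in T^1_V(L_VY).$$ 2. There is a map $J$ from $L_VY$ to the space of linear maps from projectable vector fields to $\mathbb R^{n+k}$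 with $\langle J(w),\xi\rangle=\hat J(\xi)(w)$. It is a momentum mapping for the action of $\mathrm{Aut}\,Y$ on $L_VY$: the action is smooth and preserves $d(i^*\theta)$, and $d\hat J(\xi)=-\xi_{L_VY}\lrcorner\, d(i^*\theta)$ for all projectable $\xi$. It is $\mathrm{Ad}^*$-equivariant: $\hat J(\mathrm{Ad}_\eta^{-1}\xi)=\eta_{L_VY}^*\hat J(\xi)$ for all $\eta\in\mathrm{Aut}\,Y$ and all projectable $\xi$. 3. If the standard fiber $F$ is connected, then every $f\in T^1_V(L_VY)$ equals $\hat J(\xi)$ for some projectable vector field $\xi$. -/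

import Mathlib

open Set Filter Topology
open scoped Manifold ContDiff

/-- The model space `ℝⁿ × ℝᵏ = ℝⁿ⁺ᵏ`, in which frames are indexed and observables take values.
The standard basis is `r̂ᵢ = (rᵢ, 0)`, `ŝ_A = (0, s_A)`. -/
abbrev RSum (n k : ℕ) : Type := EuclideanSpace ℝ (Fin n) × EuclideanSpace ℝ (Fin k)

/-- Block lower triangular matrices `(N, K, A)`, standing for `[[N, 0], [A, K]]`. -/
abbrev BlockTri (n k : ℕ) : Type :=
  (EuclideanSpace ℝ (Fin n) →L[ℝ] EuclideanSpace ℝ (Fin n)) ×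
  (EuclideanSpace ℝ (Fin k) →L[ℝ] EuclideanSpace ℝ (Fin k)) ×
  (EuclideanSpace ℝ (Fin n) →L[ℝ] EuclideanSpace ℝ (Fin k))

/-- The model space of the vertically adapted frame bundle. -/
abbrev FrameModel (n k : ℕ) : Type := RSum n k × BlockTri n k

/-- The linear map `(u, v) ↦ (N u, A u + K v)`. -/
noncomputable def BlockTri.toCLM {n k : ℕ} (b : BlockTri n k) : RSum n k →L[ℝ] RSum n k :=
  (b.1 ∘L ContinuousLinearMap.fst ℝ _ _).prod
    (b.2.2 ∘L ContinuousLinearMap.fst ℝ _ _ + b.2.1 ∘L ContinuousLinearMap.snd ℝ _ _)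

/-- The blocks `(N, K, A)` of a linear endomorphism of `ℝⁿ × ℝᵏ` (the upper right block is
forgotten). -/
noncomputable def BlockTri.ofCLM {n k : ℕ} (W : RSum n k →L[ℝ] RSum n k) : BlockTri n k :=
  (ContinuousLinearMap.fst ℝ _ _ ∘L W ∘L ContinuousLinearMap.inl ℝ _ _,
    ContinuousLinearMap.snd ℝ _ _ ∘L W ∘L ContinuousLinearMap.inr ℝ _ _,
    ContinuousLinearMap.snd ℝ _ _ ∘L W ∘L ContinuousLinearMap.inl ℝ _ _)

namespace BlockTri

variable {n k : ℕ}

lemma toCLM_apply (b : BlockTri n k) (u : RSum n k) :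
    b.toCLM u = (b.1 u.1, b.2.2 u.1 + b.2.1 u.2) := rfl

lemma ofCLM_toCLM (b : BlockTri n k) : ofCLM b.toCLM = b := by
  refine Prod.ext ?_ (Prod.ext ?_ ?_) <;> ext1 v <;> simp [ofCLM, toCLM_apply]

lemma toCLM_ofCLM (W : RSum n k →L[ℝ] RSum n k) (hW : ∀ u, u.1 = 0 → (W u).1 = 0) :
    (ofCLM W).toCLM = W := by
  refine ContinuousLinearMap.ext fun u => ?_
  have h : u = (u.1, 0) + (0, u.2) := by simp
  conv_rhs => rw [h, map_add]
  refine Prod.ext ?_ ?_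
  · simp [toCLM_apply, ofCLM, hW (0, u.2) rfl]
  · simp [toCLM_apply, ofCLM]

/-- The diagonal blocks are invertible. -/
def Inv (b : BlockTri n k) : Prop := b.1.IsInvertible ∧ b.2.1.IsInvertible

/-- The isomorphism `(u, v) ↦ (N u, A u + K v)` of an invertible block matrix. -/
noncomputable def Inv.equiv {b : BlockTri n k} (h : b.Inv) : RSum n k ≃L[ℝ] RSum n k :=
  h.1.choose.skewProd h.2.choose b.2.2

lemma Inv.equiv_apply {b : BlockTri n k} (h : b.Inv) (u : RSum n k) :
    h.equiv u = b.toCLM u := by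
  have h1 : b.1 u.1 = h.1.choose u.1 := congrArg (fun L => L u.1) h.1.choose_spec.symm
  have h2 : b.2.1 u.2 = h.2.choose u.2 := congrArg (fun L => L u.2) h.2.choose_spec.symm
  rw [toCLM_apply, h1, h2, add_comm]
  rfl

lemma Inv.fst_eq_zero_iff {b : BlockTri n k} (h : b.Inv) (u : RSum n k) :
    (h.equiv u).1 = 0 ↔ u.1 = 0 :=
  h.1.choose.map_eq_zero_iff

lemma isOpen_setOf_inv : IsOpen {b : BlockTri n k | b.Inv} :=
  ((ContinuousLinearEquiv.isOpen (𝕜 := ℝ)).preimage continuous_fst).inter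
    ((ContinuousLinearEquiv.isOpen (𝕜 := ℝ)).preimage (continuous_fst.comp continuous_snd))

lemma isInvertible_of_injective {m : ℕ}
    (L : EuclideanSpace ℝ (Fin m) →L[ℝ] EuclideanSpace ℝ (Fin m))
    (hL : ∀ u, L u = 0 → u = 0) : L.IsInvertible :=
  ⟨(LinearEquiv.ofInjectiveEndo L.toLinearMap
    ((injective_iff_map_eq_zero L.toLinearMap).2 hL)).toContinuousLinearEquiv, by ext; rfl⟩

lemma inv_ofCLM (W : RSum n k →L[ℝ] RSum n k) (h0 : ∀ u, W u = 0 → u = 0)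
    (hW : ∀ u, (W u).1 = 0 ↔ u.1 = 0) : (ofCLM W).Inv := by
  refine ⟨isInvertible_of_injective _ fun u hu => (hW (u, 0)).1 hu,
    isInvertible_of_injective _ fun v hv => ?_⟩
  have : W (0, v) = 0 := Prod.ext ((hW (0, v)).2 rfl) hv
  exact (Prod.ext_iff.1 (h0 _ this)).2

lemma contDiff_toCLM : ContDiff ℝ ∞ (toCLM (n := n) (k := k)) := by
  have h : toCLM (n := n) (k := k) = fun b =>
      ContinuousLinearMap.inl ℝ _ _ ∘L (b.1 ∘L ContinuousLinearMap.fst ℝ _ _) +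
      ContinuousLinearMap.inr ℝ _ _ ∘L (b.2.2 ∘L ContinuousLinearMap.fst ℝ _ _ +
        b.2.1 ∘L ContinuousLinearMap.snd ℝ _ _) := by
    funext b
    refine ContinuousLinearMap.ext fun u => ?_
    simp [toCLM_apply]
  rw [h]
  fun_prop

lemma contDiff_ofCLM : ContDiff ℝ ∞ (ofCLM (n := n) (k := k)) := by
  unfold ofCLM
  fun_prop

end BlockTri

/-- The exterior derivative `dα (u, v)` of a `V`-valued one-form `α` on a manifold `M`, taken at `x`
in the preferred chart around `x`. Here `dα (Z, W) = Z (α W) - W (α Z) - α [Z, W]`, without a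
factor `1/2`. -/
noncomputable def oneFormExtDeriv {E V M : Type*} [NormedAddCommGroup E] [NormedSpace ℝ E]
    [NormedAddCommGroup V] [NormedSpace ℝ V] [TopologicalSpace M] [ChartedSpace E M]
    (α : ∀ x : M, TangentSpace 𝓘(ℝ, E) x →L[ℝ] V) (x : M) (u v : TangentSpace 𝓘(ℝ, E) x) : V :=
  extDeriv
    (fun p : E => ContinuousAlternatingMap.ofSubsingleton ℝ E V (0 : Fin 1)
      (α ((extChartAt 𝓘(ℝ, E) x).symm p) ∘L
        (mfderiv 𝓘(ℝ, E) 𝓘(ℝ, E) (extChartAt 𝓘(ℝ, E) x).symm p :)))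
    (extChartAt 𝓘(ℝ, E) x x)
    ![mfderiv 𝓘(ℝ, E) 𝓘(ℝ, E) (extChartAt 𝓘(ℝ, E) x) x u,
      mfderiv 𝓘(ℝ, E) 𝓘(ℝ, E) (extChartAt 𝓘(ℝ, E) x) x v]

/-- The vector space of smooth vector fields on a manifold modelled on `E`. -/
abbrev SmoothVectorField (E M : Type*) [NormedAddCommGroup E] [NormedSpace ℝ E]
    [TopologicalSpace M] [ChartedSpace E M] [IsManifold 𝓘(ℝ, E) ∞ M] : Type _ :=
  ContMDiffSection 𝓘(ℝ, E) E ∞ (TangentSpace 𝓘(ℝ, E) : M → Type _)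

/-- A smooth fiber bundle `proj : Y → X` with standard fiber `F`, where `dim X = n` and
`dim F = k`. -/
structure SmoothFiberBundle (n k : ℕ) (X Y F : Type*)
    [TopologicalSpace X] [ChartedSpace (EuclideanSpace ℝ (Fin n)) X]
    [TopologicalSpace Y] [ChartedSpace (EuclideanSpace ℝ (Fin (n + k))) Y]
    [TopologicalSpace F] [ChartedSpace (EuclideanSpace ℝ (Fin k)) F] where
  /-- the bundle projection -/
  proj : Y → X
  exists_trivialization : ∀ x : X, ∃ e : Bundle.Trivialization F proj, x ∈ e.baseSet ∧
    ContMDiffOn (𝓡 (n + k)) ((𝓡 n).prod (𝓡 k)) ∞ e e.source ∧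
    ContMDiffOn ((𝓡 n).prod (𝓡 k)) (𝓡 (n + k)) ∞ e.toOpenPartialHomeomorph.symm e.target

namespace SmoothFiberBundle

section Frames

variable {n k : ℕ} {X Y F : Type*}
  [TopologicalSpace X] [ChartedSpace (EuclideanSpace ℝ (Fin n)) X]
  [TopologicalSpace Y] [ChartedSpace (EuclideanSpace ℝ (Fin (n + k))) Y]
  [TopologicalSpace F] [ChartedSpace (EuclideanSpace ℝ (Fin k)) F]

/-- The vertically adapted frame bundle `L_V Y`: a point is a linear frame of `Y` at `base`, seen
as an isomorphism `w : ℝⁿ × ℝᵏ ≃ T_y Y`, whose last `k` vectors form a frame of the vertical space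
`V(T_y Y) = ker (d proj)`. -/
@[ext]
structure LVY (B : SmoothFiberBundle n k X Y F) where
  /-- the point `y` at which the frame sits -/
  base : Y
  /-- the frame -/
  frame : RSum n k ≃L[ℝ] TangentSpace (𝓡 (n + k)) base
  vertical : ∀ u : RSum n k, mfderiv (𝓡 (n + k)) (𝓡 n) B.proj base (frame u) = 0 ↔ u.1 = 0

/-- The tangent vector `w u` of `Y`, as a point of the tangent bundle. -/
noncomputable def LVY.vec {B : SmoothFiberBundle n k X Y F} (w : B.LVY) (u : RSum n k) :
    TangentBundle (𝓡 (n + k)) Y :=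
  ⟨w.base, w.frame u⟩

/-- An adapted chart `(xⁱ, y^A)` of `Y`: its first `n` coordinates come from a chart of `X`. -/
structure AdaptedChart (B : SmoothFiberBundle n k X Y F) where
  /-- the chart of `Y` -/
  total : OpenPartialHomeomorph Y (RSum n k)
  /-- the underlying chart of `X` -/
  base : OpenPartialHomeomorph X (EuclideanSpace ℝ (Fin n))
  contMDiffOn : ContMDiffOn (𝓡 (n + k)) 𝓘(ℝ, RSum n k) ∞ total total.source
  contMDiffOn_symm : ContMDiffOn 𝓘(ℝ, RSum n k) (𝓡 (n + k)) ∞ total.symm total.target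
  contMDiffOn_base : ContMDiffOn (𝓡 n) (𝓡 n) ∞ base base.source
  contMDiffOn_base_symm : ContMDiffOn (𝓡 n) (𝓡 n) ∞ base.symm base.target
  mapsTo : ∀ y ∈ total.source, B.proj y ∈ base.source
  base_proj : ∀ y ∈ total.source, base (B.proj y) = (total y).1

namespace AdaptedChart

variable {B : SmoothFiberBundle n k X Y F} (φ : B.AdaptedChart)

lemma mdifferentiable : φ.total.MDifferentiable (𝓡 (n + k)) 𝓘(ℝ, RSum n k) :=
  ⟨φ.contMDiffOn.mdifferentiableOn (by simp), φ.contMDiffOn_symm.mdifferentiableOn (by simp)⟩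

lemma mdifferentiable_base : φ.base.MDifferentiable (𝓡 n) (𝓡 n) :=
  ⟨φ.contMDiffOn_base.mdifferentiableOn (by simp),
    φ.contMDiffOn_base_symm.mdifferentiableOn (by simp)⟩

/-- The differential of the chart, as an isomorphism `T_y Y ≃ ℝⁿ × ℝᵏ`. -/
noncomputable def deriv {y : Y} (hy : y ∈ φ.total.source) :
    TangentSpace (𝓡 (n + k)) y ≃L[ℝ] RSum n k :=
  φ.mdifferentiable.mfderiv hy

lemma deriv_apply {y : Y} (hy : y ∈ φ.total.source) (z : TangentSpace (𝓡 (n + k)) y) :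
    φ.deriv hy z = mfderiv (𝓡 (n + k)) 𝓘(ℝ, RSum n k) φ.total y z := rfl

lemma mdifferentiableAt_proj {y : Y} (hy : y ∈ φ.total.source) :
    MDifferentiableAt (𝓡 (n + k)) (𝓡 n) B.proj y := by
  have h1 : MDifferentiableAt (𝓡 (n + k)) (𝓡 n) (fun y => (φ.total y).1) y :=
    ((contDiff_fst (𝕜 := ℝ) (n := 1)).contMDiff.mdifferentiable (by simp) _).comp y
      (φ.mdifferentiable.mdifferentiableAt hy)
  have h2 : MDifferentiableAt (𝓡 n) (𝓡 n) φ.base.symm ((φ.total y).1) := by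
    rw [← φ.base_proj y hy]
    exact φ.mdifferentiable_base.mdifferentiableAt_symm
      (φ.base.map_source (φ.mapsTo y hy))
  refine (h2.comp y h1).congr_of_eventuallyEq ?_
  filter_upwards [φ.total.open_source.mem_nhds hy] with y' hy'
  simp only [Function.comp, ← φ.base_proj y' hy', φ.base.left_inv (φ.mapsTo y' hy')]

lemma vertical_iff {y : Y} (hy : y ∈ φ.total.source) (z : TangentSpace (𝓡 (n + k)) y) :
    mfderiv (𝓡 (n + k)) (𝓡 n) B.proj y z = 0 ↔ (φ.deriv hy z).1 = 0 := by
  have hb := φ.mdifferentiable_base.mdifferentiableAt (φ.mapsTo y hy)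
  have e1 := mfderiv_comp y hb (φ.mdifferentiableAt_proj hy)
  have hf : MDifferentiableAt 𝓘(ℝ, RSum n k) (𝓡 n) (Prod.fst : RSum n k → _) (φ.total y) :=
    (contDiff_fst (𝕜 := ℝ) (n := 1)).contMDiff.mdifferentiable (by simp) _
  have e2 := mfderiv_comp y hf (φ.mdifferentiable.mdifferentiableAt hy)
  have e3 : (φ.base ∘ B.proj) =ᶠ[𝓝 y] (Prod.fst ∘ φ.total) := by
    filter_upwards [φ.total.open_source.mem_nhds hy] with y' hy'
    exact φ.base_proj y' hy'
  have e4 := e3.mfderiv_eq (I := 𝓡 (n + k)) (I' := 𝓡 n)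
  have e5 : mfderiv 𝓘(ℝ, RSum n k) (𝓡 n) (Prod.fst : RSum n k → _) (φ.total y) =
      (ContinuousLinearMap.fst ℝ (EuclideanSpace ℝ (Fin n)) (EuclideanSpace ℝ (Fin k)) :) := by
    rw [mfderiv_eq_fderiv]; exact fderiv_fst
  have e6 : mfderiv (𝓡 n) (𝓡 n) φ.base (B.proj y) (mfderiv (𝓡 (n + k)) (𝓡 n) B.proj y z) =
      (φ.deriv hy z).1 := by
    have := congrArg (fun L => L z) (e1.symm.trans (e4.trans e2))
    rw [e5] at this
    exact this
  rw [← e6]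
  constructor
  · intro h; rw [h]; exact map_zero _
  · intro h
    exact φ.mdifferentiable_base.mfderiv_injective (φ.mapsTo y hy) (h.trans (map_zero _).symm)

/-- The matrix of the frame `w` in the chart. -/
noncomputable def matrix (w : B.LVY) (hw : w.base ∈ φ.total.source) : RSum n k ≃L[ℝ] RSum n k :=
  w.frame.trans (φ.deriv hw)

lemma matrix_fst (w : B.LVY) (hw : w.base ∈ φ.total.source) (u : RSum n k) :
    (φ.matrix w hw u).1 = 0 ↔ u.1 = 0 :=
  (φ.vertical_iff hw (w.frame u)).symm.trans (w.vertical u)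

/-- The coordinates of a frame in the chart: the coordinates of the base point, and the blocks of
the matrix whose columns are the coordinates of the vectors of the frame. -/
noncomputable def coord (w : B.LVY) : FrameModel n k :=
  (φ.total w.base,
    BlockTri.ofCLM ((mfderiv (𝓡 (n + k)) 𝓘(ℝ, RSum n k) φ.total w.base :) ∘L
      (w.frame : RSum n k →L[ℝ] TangentSpace (𝓡 (n + k)) w.base)))

lemma coord_eq (w : B.LVY) (hw : w.base ∈ φ.total.source) :
    φ.coord w = (φ.total w.base, BlockTri.ofCLM (φ.matrix w hw : RSum n k →L[ℝ] RSum n k)) := rfl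

lemma toCLM_coord (w : B.LVY) (hw : w.base ∈ φ.total.source) :
    (φ.coord w).2.toCLM = (φ.matrix w hw : RSum n k →L[ℝ] RSum n k) :=
  BlockTri.toCLM_ofCLM _ fun u hu => (φ.matrix_fst w hw u).2 hu

lemma inv_coord (w : B.LVY) (hw : w.base ∈ φ.total.source) : (φ.coord w).2.Inv :=
  BlockTri.inv_ofCLM _ (fun _ h => (φ.matrix w hw).map_eq_zero_iff.1 h) (φ.matrix_fst w hw)

/-- The frame over `φ⁻¹ p` with matrix `b` in the chart `φ`. -/
noncomputable def frameOf (q : FrameModel n k) (hp : q.1 ∈ φ.total.target) (hb : q.2.Inv) :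
    B.LVY where
  base := φ.total.symm q.1
  frame := hb.equiv.trans (φ.deriv (φ.total.map_target hp)).symm
  vertical u := by
    rw [φ.vertical_iff (φ.total.map_target hp)]
    simp [hb.fst_eq_zero_iff]

lemma coord_frameOf (q : FrameModel n k) (hp : q.1 ∈ φ.total.target) (hb : q.2.Inv) :
    φ.coord (φ.frameOf q hp hb) = q := by
  have hw : (φ.frameOf q hp hb).base ∈ φ.total.source := φ.total.map_target hp
  have hm : (φ.matrix _ hw : RSum n k →L[ℝ] RSum n k) = q.2.toCLM := by
    refine ContinuousLinearMap.ext fun u => ?_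
    rw [← hb.equiv_apply]
    exact (φ.deriv (φ.total.map_target hp)).apply_symm_apply (hb.equiv u)
  rw [φ.coord_eq _ hw, hm, BlockTri.ofCLM_toCLM]
  exact Prod.ext (φ.total.right_inv hp) rfl

lemma coord_inj {w w' : B.LVY} (hw : w.base ∈ φ.total.source) (hw' : w'.base ∈ φ.total.source)
    (h : φ.coord w = φ.coord w') : w = w' := by
  have hm : (φ.matrix w hw : RSum n k →L[ℝ] RSum n k) = φ.matrix w' hw' := by
    rw [← φ.toCLM_coord w hw, ← φ.toCLM_coord w' hw', h]
  have hb : w.base = w'.base := φ.total.injOn hw hw' (Prod.ext_iff.1 h).1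
  obtain ⟨y, f, hf⟩ := w
  obtain ⟨y', f', hf'⟩ := w'
  obtain rfl : y = y' := hb
  have : f = f' := by
    refine ContinuousLinearEquiv.ext (funext fun u => ?_)
    exact (φ.deriv hw).injective (congrArg (fun L => L u) hm)
  subst this
  rfl

/-- The chart of `L_V Y` induced by an adapted chart of `Y` (`w₀` is only a junk value). -/
noncomputable def frameChart (w₀ : B.LVY) : PartialEquiv B.LVY (FrameModel n k) where
  toFun := φ.coord
  invFun q := open Classical in
    if h : q.1 ∈ φ.total.target ∧ q.2.Inv then φ.frameOf q h.1 h.2 else w₀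
  source := {w | w.base ∈ φ.total.source}
  target := {q | q.1 ∈ φ.total.target ∧ q.2.Inv}
  map_source' w hw := ⟨φ.total.map_source hw, φ.inv_coord w hw⟩
  map_target' q hq := by
    have hq' : q.1 ∈ φ.total.target ∧ q.2.Inv := hq
    rw [dif_pos hq']
    exact φ.total.map_target hq.1
  left_inv' w hw := by
    have hq' : (φ.coord w).1 ∈ φ.total.target ∧ (φ.coord w).2.Inv :=
      ⟨φ.total.map_source hw, φ.inv_coord w hw⟩
    rw [dif_pos hq']
    exact φ.coord_inj (φ.total.map_target hq'.1) hw (φ.coord_frameOf _ _ _)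
  right_inv' q hq := by
    have hq' : q.1 ∈ φ.total.target ∧ q.2.Inv := hq
    rw [dif_pos hq']
    exact φ.coord_frameOf _ _ _

lemma frameChart_symm_base (w₀ : B.LVY) {q : FrameModel n k}
    (hq : q ∈ (φ.frameChart w₀).target) :
    ((φ.frameChart w₀).symm q).base = φ.total.symm q.1 := by
  have hq' : q.1 ∈ φ.total.target ∧ q.2.Inv := hq
  have h : (φ.frameChart w₀).symm q = φ.frameOf q hq'.1 hq'.2 := dif_pos hq'
  rw [h]
  rfl

/-- The coordinates of one frame in two charts are related by the Jacobian of the transition map. -/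
lemma coord_change (φ' : B.AdaptedChart) (w : B.LVY) (hw : w.base ∈ φ.total.source)
    (hw' : w.base ∈ φ'.total.source) :
    φ'.coord w = (φ'.total (φ.total.symm (φ.coord w).1),
      BlockTri.ofCLM (fderiv ℝ (φ'.total ∘ φ.total.symm) (φ.coord w).1 ∘L
        (φ.coord w).2.toCLM)) := by
  have hb : φ.total.symm (φ.coord w).1 = w.base := φ.total.left_inv hw
  refine Prod.ext (congrArg φ'.total hb.symm) ?_
  change BlockTri.ofCLM (φ'.matrix w hw' : RSum n k →L[ℝ] RSum n k) = _
  congr 1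
  rw [φ.toCLM_coord w hw]
  have hp : (φ.coord w).1 ∈ φ.total.target := φ.total.map_source hw
  have hτ : MDifferentiableAt 𝓘(ℝ, RSum n k) 𝓘(ℝ, RSum n k) (φ'.total ∘ φ.total.symm)
      (φ.total w.base) :=
    MDifferentiableAt.comp _ (φ'.mdifferentiable.mdifferentiableAt (by
      change φ.total.symm (φ.coord w).1 ∈ _
      rwa [hb])) (φ.mdifferentiable.mdifferentiableAt_symm hp)
  have h1 := mfderiv_comp w.base hτ (φ.mdifferentiable.mdifferentiableAt hw)
  have h2 : ((φ'.total ∘ φ.total.symm) ∘ φ.total) =ᶠ[𝓝 w.base] φ'.total := by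
    filter_upwards [φ.total.open_source.mem_nhds hw] with y hy
    simp only [Function.comp, φ.total.left_inv hy]
  have h3 := h2.mfderiv_eq (I := 𝓡 (n + k)) (I' := 𝓘(ℝ, RSum n k))
  rw [mfderiv_eq_fderiv] at h1
  refine ContinuousLinearMap.ext fun u => ?_
  exact congrArg (fun L => L (w.frame u)) (h3.symm.trans h1)

/-- The transition map between two charts of `L_V Y`. -/
lemma contDiffOn_transition (φ' : B.AdaptedChart) (w₀ w₀' : B.LVY) :
    IsOpen ((φ.frameChart w₀).symm.trans (φ'.frameChart w₀')).source ∧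
    ContDiffOn ℝ ∞ ((φ.frameChart w₀).symm.trans (φ'.frameChart w₀'))
      ((φ.frameChart w₀).symm.trans (φ'.frameChart w₀')).source := by
  have hS : ((φ.frameChart w₀).symm.trans (φ'.frameChart w₀')).source =
      {q | q.1 ∈ (φ.total.symm.trans φ'.total).source ∧ q.2.Inv} := by
    ext q
    constructor
    · rintro ⟨h1, h2⟩
      have h3 := φ.frameChart_symm_base w₀ h1
      refine ⟨⟨h1.1, ?_⟩, h1.2⟩
      have h2' : ((φ.frameChart w₀).symm q).base ∈ φ'.total.source := h2
      rwa [h3] at h2'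
    · rintro ⟨h1, h2⟩
      have h4 : q ∈ (φ.frameChart w₀).target := ⟨h1.1, h2⟩
      refine ⟨h4, ?_⟩
      change ((φ.frameChart w₀).symm q).base ∈ φ'.total.source
      rw [φ.frameChart_symm_base w₀ h4]
      exact h1.2
  have hτ : ContDiffOn ℝ ∞ (φ'.total ∘ φ.total.symm) (φ.total.symm.trans φ'.total).source := by
    rw [← contMDiffOn_iff_contDiffOn]
    exact φ'.contMDiffOn.comp (φ.contMDiffOn_symm.mono fun p hp => hp.1) fun p hp => hp.2
  have hO := (φ.total.symm.trans φ'.total).open_source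
  refine ⟨?_, ?_⟩
  · rw [hS]
    exact (hO.preimage continuous_fst).inter (BlockTri.isOpen_setOf_inv.preimage continuous_snd)
  · have h1 : ContDiffOn ℝ ∞ (fun q : FrameModel n k =>
        (φ'.total (φ.total.symm q.1),
          BlockTri.ofCLM (fderiv ℝ (φ'.total ∘ φ.total.symm) q.1 ∘L q.2.toCLM)))
        {q | q.1 ∈ (φ.total.symm.trans φ'.total).source ∧ q.2.Inv} := by
      refine ContDiffOn.prodMk ?_ ?_
      · exact hτ.comp contDiff_fst.contDiffOn fun q hq => hq.1
      · refine BlockTri.contDiff_ofCLM.comp_contDiffOn (ContDiffOn.clm_comp ?_ ?_)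
        · exact (hτ.fderiv_of_isOpen hO (m := ∞) (by simp)).comp contDiff_fst.contDiffOn
            fun q hq => hq.1
        · exact (BlockTri.contDiff_toCLM.comp contDiff_snd).contDiffOn
    rw [hS]
    refine h1.congr fun q hq => ?_
    have h4 : q ∈ (φ.frameChart w₀).target := ⟨hq.1.1, hq.2⟩
    have h5 : φ.coord ((φ.frameChart w₀).symm q) = q := (φ.frameChart w₀).right_inv h4
    have h6 := φ.coord_change φ' ((φ.frameChart w₀).symm q)
      ((φ.frameChart w₀).map_target h4) (by
        rw [φ.frameChart_symm_base w₀ h4]; exact hq.1.2)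
    rw [h5] at h6
    exact h6

end AdaptedChart

/-- Every point of `Y` lies in an adapted chart. -/
lemma exists_adaptedChart [IsManifold (𝓡 n) ∞ X] [IsManifold (𝓡 k) ∞ F]
    (B : SmoothFiberBundle n k X Y F) (y : Y) :
    ∃ φ : B.AdaptedChart, y ∈ φ.total.source := by
  obtain ⟨e, he, h1, h2⟩ := B.exists_trivialization (B.proj y)
  have hy : y ∈ e.source := e.mem_source.2 he
  let cX := chartAt (EuclideanSpace ℝ (Fin n)) (B.proj y)
  let cF := chartAt (EuclideanSpace ℝ (Fin k)) (e y).2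
  let T : OpenPartialHomeomorph Y (RSum n k) := e.toOpenPartialHomeomorph.trans (cX.prod cF)
  have hT : ∀ y' ∈ T.source, y' ∈ e.source ∧ B.proj y' ∈ cX.source ∧ (e y').2 ∈ cF.source := by
    intro y' hy'
    have h3 : y' ∈ e.source := hy'.1
    have h4 : (e y').1 ∈ cX.source ∧ (e y').2 ∈ cF.source := hy'.2
    rw [e.coe_fst h3] at h4
    exact ⟨h3, h4⟩
  refine ⟨⟨T, cX, ?_, ?_, contMDiffOn_chart, contMDiffOn_chart_symm, fun y' hy' => (hT y' hy').2.1,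
    fun y' hy' => ?_⟩, ?_⟩
  · have h5 : ContMDiffOn (𝓡 (n + k)) ((𝓡 n).prod (𝓡 k)) ∞ e T.source :=
      h1.mono fun y' hy' => (hT y' hy').1
    refine ContMDiffOn.prodMk_space (f := fun y' => cX (e y').1) (g := fun y' => cF (e y').2) ?_ ?_
    · exact contMDiffOn_chart.comp (contMDiff_fst.comp_contMDiffOn h5) fun y' hy' => hy'.2.1
    · exact contMDiffOn_chart.comp (contMDiff_snd.comp_contMDiffOn h5) fun y' hy' => hy'.2.2
  · refine h2.comp (t := e.target) (f := fun p : RSum n k => (cX.symm p.1, cF.symm p.2)) ?_ ?_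
    · refine ContMDiffOn.prodMk ?_ ?_
      · exact contMDiffOn_chart_symm.comp contDiff_fst.contMDiff.contMDiffOn
          fun p hp => hp.1.1
      · exact contMDiffOn_chart_symm.comp contDiff_snd.contMDiff.contMDiffOn
          fun p hp => hp.1.2
    · exact fun p hp => hp.2
  · change cX (B.proj y') = cX (e y').1
    rw [e.coe_fst (hT y' hy').1]
  · refine ⟨hy, ?_⟩
    change (e y).1 ∈ cX.source ∧ (e y).2 ∈ cF.source
    rw [e.coe_fst hy]
    exact ⟨mem_chart_source _ _, mem_chart_source _ _⟩

variable [IsManifold (𝓡 n) ∞ X] [IsManifold (𝓡 k) ∞ F]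

/-- A choice of an adapted chart around a point of `Y`. -/
noncomputable def adaptedChartAt (B : SmoothFiberBundle n k X Y F) (y : Y) : B.AdaptedChart :=
  (B.exists_adaptedChart y).choose

lemma mem_adaptedChartAt (B : SmoothFiberBundle n k X Y F) (y : Y) :
    y ∈ (B.adaptedChartAt y).total.source :=
  (B.exists_adaptedChart y).choose_spec

/-- The smooth atlas of `L_V Y` consisting of the charts induced by the adapted charts of `Y`. -/
noncomputable def LVY.core (B : SmoothFiberBundle n k X Y F) :
    ChartedSpaceCore (FrameModel n k) B.LVY where
  atlas := {e | ∃ (φ : B.AdaptedChart) (w₀ : B.LVY), e = φ.frameChart w₀}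
  chartAt w := (B.adaptedChartAt w.base).frameChart w
  mem_chart_source w := B.mem_adaptedChartAt w.base
  chart_mem_atlas w := ⟨_, _, rfl⟩
  open_source := by
    rintro _ _ ⟨φ, w, rfl⟩ ⟨φ', w', rfl⟩
    exact (φ.contDiffOn_transition φ' w w').1
  continuousOn_toFun := by
    rintro _ _ ⟨φ, w, rfl⟩ ⟨φ', w', rfl⟩
    exact (φ.contDiffOn_transition φ' w w').2.continuousOn

noncomputable instance (B : SmoothFiberBundle n k X Y F) : TopologicalSpace B.LVY :=
  (LVY.core B).toTopologicalSpace

noncomputable instance (B : SmoothFiberBundle n k X Y F) : ChartedSpace (FrameModel n k) B.LVY :=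
  (LVY.core B).toChartedSpace

instance (B : SmoothFiberBundle n k X Y F) : IsManifold 𝓘(ℝ, FrameModel n k) ∞ B.LVY := by
  refine isManifold_of_contDiffOn _ _ _ ?_
  intro e e' he he'
  obtain ⟨e₀, he₀, he⟩ := mem_iUnion₂.1 he
  obtain ⟨e₀', he₀', he'⟩ := mem_iUnion₂.1 he'
  obtain ⟨φ, w, rfl⟩ := he₀
  obtain ⟨φ', w', rfl⟩ := he₀'
  obtain rfl : e = _ := he
  obtain rfl : e' = _ := he'
  have h := (φ.contDiffOn_transition φ' w w').2
  refine h.mono ?_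
  rintro q ⟨hq, -⟩
  exact hq

/-- The right action `w · (N, K, A)` of the adapted linear group on `L_V Y`: the new frame is
`{eⱼ Nʲᵢ + ε_B Aᴮᵢ, ε_B Kᴮ_A}`. -/
noncomputable def LVY.act {B : SmoothFiberBundle n k X Y F} (w : B.LVY)
    (N : EuclideanSpace ℝ (Fin n) ≃L[ℝ] EuclideanSpace ℝ (Fin n))
    (K : EuclideanSpace ℝ (Fin k) ≃L[ℝ] EuclideanSpace ℝ (Fin k))
    (A : EuclideanSpace ℝ (Fin n) →L[ℝ] EuclideanSpace ℝ (Fin k)) : B.LVY where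
  base := w.base
  frame := (N.skewProd K A).trans w.frame
  vertical _ := (w.vertical _).trans N.map_eq_zero_iff

/-- The soldering form of the linear frame bundle restricted to `L_V Y`:
`(i^*θ)_w (Z) = w⁻¹ (dπ Z)`, where `π : L_V Y → Y`. -/
noncomputable def soldering (B : SmoothFiberBundle n k X Y F) (w : B.LVY) :
    TangentSpace 𝓘(ℝ, FrameModel n k) w →L[ℝ] RSum n k :=
  (w.frame.symm : TangentSpace (𝓡 (n + k)) w.base →L[ℝ] RSum n k) ∘L
    mfderiv 𝓘(ℝ, FrameModel n k) (𝓡 (n + k)) (fun w : B.LVY => w.base) w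

/-- The structure form `i^*dθ = d (i^*θ)`. -/
noncomputable def structureForm (B : SmoothFiberBundle n k X Y F) (w : B.LVY)
    (u v : TangentSpace 𝓘(ℝ, FrameModel n k) w) : RSum n k :=
  oneFormExtDeriv B.soldering w u v

/-- `df = - Z ⌟ i^*dθ`. -/
def IsHamiltonianPair (B : SmoothFiberBundle n k X Y F) (f : B.LVY → RSum n k)
    (Z : SmoothVectorField (FrameModel n k) B.LVY) : Prop :=
  ∀ (w : B.LVY) (v : TangentSpace 𝓘(ℝ, FrameModel n k) w),
    mfderiv 𝓘(ℝ, FrameModel n k) 𝓘(ℝ, RSum n k) f w v = - B.structureForm w (Z w) v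

/-- `HF¹(L_V Y)`: the smooth `ℝⁿ⁺ᵏ`-valued Hamiltonian observables. -/
def HF1 (B : SmoothFiberBundle n k X Y F) : Set (B.LVY → RSum n k) :=
  {f | ContMDiff 𝓘(ℝ, FrameModel n k) 𝓘(ℝ, RSum n k) ∞ f ∧
    ∃ Z : SmoothVectorField (FrameModel n k) B.LVY, B.IsHamiltonianPair f Z}

/-- `T¹(L_V Y)`: the smooth tensorial functions, `f (w · g) = g⁻¹ f (w)`. -/
def T1 (B : SmoothFiberBundle n k X Y F) : Set (B.LVY → RSum n k) :=
  {f | ContMDiff 𝓘(ℝ, FrameModel n k) 𝓘(ℝ, RSum n k) ∞ f ∧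
    ∀ (w : B.LVY) (N : EuclideanSpace ℝ (Fin n) ≃L[ℝ] EuclideanSpace ℝ (Fin n))
      (K : EuclideanSpace ℝ (Fin k) ≃L[ℝ] EuclideanSpace ℝ (Fin k))
      (A : EuclideanSpace ℝ (Fin n) →L[ℝ] EuclideanSpace ℝ (Fin k)),
      f (w.act N K A) = (N.skewProd K A).symm (f w)}

/-- `T¹_V(L_V Y)`: the tensorial Hamiltonian observables. -/
def T1V (B : SmoothFiberBundle n k X Y F) : Set (B.LVY → RSum n k) :=
  B.HF1 ∩ B.T1

/-- The group `Aut Y`: diffeomorphisms of `Y` that cover a diffeomorphism of `X`. -/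
structure Aut (B : SmoothFiberBundle n k X Y F) where
  /-- the diffeomorphism of `Y` -/
  toDiffeo : Y ≃ₘ^∞⟮𝓡 (n + k), 𝓡 (n + k)⟯ Y
  covers : ∃ ηX : X ≃ₘ^∞⟮𝓡 n, 𝓡 n⟯ X, ∀ y, B.proj (toDiffeo y) = ηX (B.proj y)

namespace Aut

variable {B : SmoothFiberBundle n k X Y F}

/-- The inverse automorphism. -/
noncomputable def inv (η : B.Aut) : B.Aut where
  toDiffeo := η.toDiffeo.symm
  covers := by
    obtain ⟨ηX, h⟩ := η.covers
    refine ⟨ηX.symm, fun y => ?_⟩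
    rw [← ηX.symm_apply_apply (B.proj (η.toDiffeo.symm y)), ← h, η.toDiffeo.apply_symm_apply]

lemma proj_mfderiv (η : B.Aut) (ηX : X ≃ₘ^∞⟮𝓡 n, 𝓡 n⟯ X)
    (h : ∀ y, B.proj (η.toDiffeo y) = ηX (B.proj y)) (y : Y)
    (z : TangentSpace (𝓡 (n + k)) y) :
    mfderiv (𝓡 (n + k)) (𝓡 n) B.proj (η.toDiffeo y)
      (mfderiv (𝓡 (n + k)) (𝓡 (n + k)) η.toDiffeo y z) =
    mfderiv (𝓡 n) (𝓡 n) ηX (B.proj y) (mfderiv (𝓡 (n + k)) (𝓡 n) B.proj y z) := by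
  have hp : ∀ y, MDifferentiableAt (𝓡 (n + k)) (𝓡 n) B.proj y := fun y =>
    (B.adaptedChartAt y).mdifferentiableAt_proj (B.mem_adaptedChartAt y)
  have e1 := mfderiv_comp y (hp (η.toDiffeo y)) (η.toDiffeo.mdifferentiable (by simp) y)
  have e2 := mfderiv_comp y (ηX.mdifferentiable (by simp) (B.proj y)) (hp y)
  have e3 : B.proj ∘ η.toDiffeo = ηX ∘ B.proj := funext h
  rw [e3] at e1
  exact congrArg (fun L => L z) (e1.symm.trans e2)

/-- The canonical lift `η_{L_V Y}`: `w ↦ η_* ∘ w`. -/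
noncomputable def lift (η : B.Aut) (w : B.LVY) : B.LVY where
  base := η.toDiffeo w.base
  frame := w.frame.trans (η.toDiffeo.mfderivToContinuousLinearEquiv (by simp) w.base)
  vertical u := by
    obtain ⟨ηX, h⟩ := η.covers
    rw [← w.vertical u]
    have e := η.proj_mfderiv ηX h w.base (w.frame u)
    have e' := (ηX.mfderivToContinuousLinearEquiv (by simp) (B.proj w.base)).map_eq_zero_iff
      (x := mfderiv (𝓡 (n + k)) (𝓡 n) B.proj w.base (w.frame u))
    exact ⟨fun h0 => e'.1 (e.symm.trans h0), fun h0 => e.trans (e'.2 h0)⟩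

lemma isInvertible_mfderiv (η : B.Aut) (y : Y) :
    (mfderiv (𝓡 (n + k)) (𝓡 (n + k)) η.toDiffeo.symm y).IsInvertible :=
  ⟨η.toDiffeo.symm.mfderivToContinuousLinearEquiv (by simp) y, rfl⟩

end Aut

variable [IsManifold (𝓡 (n + k)) ∞ Y]

/-- The vector space of projectable vector fields: the smooth vector fields on `Y` that are
`proj`-related to a smooth vector field on `X`. -/
def projectable (B : SmoothFiberBundle n k X Y F) :
    Submodule ℝ (SmoothVectorField (EuclideanSpace ℝ (Fin (n + k))) Y) where
  carrier := {ξ | ∃ ζ : SmoothVectorField (EuclideanSpace ℝ (Fin n)) X,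
    ∀ y, mfderiv (𝓡 (n + k)) (𝓡 n) B.proj y (ξ y) = ζ (B.proj y)}
  add_mem' := by
    rintro ξ ξ' ⟨ζ, h⟩ ⟨ζ', h'⟩
    refine ⟨ζ + ζ', fun y => ?_⟩
    rw [ContMDiffSection.coe_add, ContMDiffSection.coe_add, Pi.add_apply, Pi.add_apply, map_add,
      h, h']
  zero_mem' := ⟨0, fun y => map_zero _⟩
  smul_mem' := by
    rintro c ξ ⟨ζ, h⟩
    refine ⟨c • ζ, fun y => ?_⟩
    rw [ContMDiffSection.coe_smul, ContMDiffSection.coe_smul, Pi.smul_apply, Pi.smul_apply,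
      map_smul, h]

/-- A smooth one-parameter family `ψ_t` of local bundle automorphisms of `Y`, defined near
`(0, y₀)`, with `ψ_0 = id` and `d/dt ψ_t = ξ` at `t = 0`. The local flow of `ξ` is such a family.
(Being invertible near `y₀` is automatic for small `t`.) -/
def IsLocalFamily (B : SmoothFiberBundle n k X Y F) (ξ : B.projectable) (y₀ : Y)
    (ψ : ℝ × Y → Y) : Prop :=
  ∃ (O : Set (ℝ × Y)) (O' : Set (ℝ × X)) (ψ' : ℝ × X → X),
    IsOpen O ∧ IsOpen O' ∧ (0, y₀) ∈ O ∧
    ContMDiffOn (𝓘(ℝ, ℝ).prod (𝓡 (n + k))) (𝓡 (n + k)) ∞ ψ O ∧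
    ContMDiffOn (𝓘(ℝ, ℝ).prod (𝓡 n)) (𝓡 n) ∞ ψ' O' ∧
    (∀ t y, (t, y) ∈ O → (t, B.proj y) ∈ O' ∧ B.proj (ψ (t, y)) = ψ' (t, B.proj y)) ∧
    (∀ y, (0, y) ∈ O → ψ (0, y) = y) ∧
    (∀ y, (0, y) ∈ O → HasMFDerivAt 𝓘(ℝ, ℝ) (𝓡 (n + k)) (fun t => ψ (t, y)) 0
      ((1 : ℝ →L[ℝ] ℝ).smulRight (ξ.1 (ψ (0, y)))))

/-- `w'` is the frame `f_* ∘ w`. -/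
def LVY.IsLift {B : SmoothFiberBundle n k X Y F} (f : Y → Y) (w w' : B.LVY) : Prop :=
  ∀ u, w'.vec u = tangentMap (𝓡 (n + k)) (𝓡 (n + k)) f (w.vec u)

/-- `Ξ` is the natural lift `ξ_{L_V Y}` of `ξ`, the infinitesimal generator of the lifted action:
near every point of `Y` there is a one-parameter family of local automorphisms generated by `ξ`, and
for every such family `ψ_t` the lifted curve `t ↦ ψ_{t*} ∘ w` in `L_V Y` has velocity `Ξ_w` at
`t = 0`. -/
structure IsNaturalLift (B : SmoothFiberBundle n k X Y F) (ξ : B.projectable)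
    (Ξ : SmoothVectorField (FrameModel n k) B.LVY) : Prop where
  exists_family : ∀ w : B.LVY, ∃ ψ, B.IsLocalFamily ξ w.base ψ
  velocity : ∀ (w : B.LVY) (ψ : ℝ × Y → Y), B.IsLocalFamily ξ w.base ψ →
    ∃ c : ℝ → B.LVY, c 0 = w ∧ (∀ᶠ t in 𝓝 (0 : ℝ), w.IsLift (fun y => ψ (t, y)) (c t)) ∧
      HasMFDerivAt 𝓘(ℝ, ℝ) 𝓘(ℝ, FrameModel n k) c 0 ((1 : ℝ →L[ℝ] ℝ).smulRight (Ξ (c 0)))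

/-- The natural lift `ξ_{L_V Y}` of a projectable vector field, chosen among all
vector fields satisfying the definition (there is exactly one). -/
noncomputable def naturalLift (B : SmoothFiberBundle n k X Y F) (ξ : B.projectable) :
    SmoothVectorField (FrameModel n k) B.LVY :=
  Classical.epsilon (B.IsNaturalLift ξ)

/-- `Ĵ(ξ) = ξ_{L_V Y} ⌟ i^*θ`. -/
noncomputable def Jhat (B : SmoothFiberBundle n k X Y F) (ξ : B.projectable) (w : B.LVY) :
    RSum n k :=
  B.soldering w (B.naturalLift ξ w)

namespace Aut

variable {B : SmoothFiberBundle n k X Y F}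

/-- The adjoint action `Ad_η ξ = η_* ξ` on projectable vector fields, where
`(η_* ξ)(y) = (d(η⁻¹)_y)⁻¹ ξ(η⁻¹ y)`. -/
noncomputable def Ad (η : B.Aut) (ξ : B.projectable) : B.projectable :=
  ⟨⟨VectorField.mpullback (𝓡 (n + k)) (𝓡 (n + k)) η.toDiffeo.symm
      ξ.1,
    ContMDiff.mpullback_vectorField ξ.1.contMDiff
      η.toDiffeo.symm.contMDiff η.isInvertible_mfderiv (by simp)⟩, by
    obtain ⟨ηX, h⟩ := η.inv.covers
    obtain ⟨ζ, hζ⟩ := ξ.2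
    have hX : ∀ x, (mfderiv (𝓡 n) (𝓡 n) ηX x).IsInvertible := fun x =>
      ⟨ηX.mfderivToContinuousLinearEquiv (by simp) x, rfl⟩
    refine ⟨⟨VectorField.mpullback (𝓡 n) (𝓡 n) ηX ζ,
      ContMDiff.mpullback_vectorField ζ.contMDiff ηX.contMDiff hX (by simp)⟩, fun y => ?_⟩
    change mfderiv (𝓡 (n + k)) (𝓡 n) B.proj y
      ((mfderiv (𝓡 (n + k)) (𝓡 (n + k)) η.toDiffeo.symm y).inverse
        (ξ.1 (η.toDiffeo.symm y))) =
      (mfderiv (𝓡 n) (𝓡 n) ηX (B.proj y)).inverse (ζ (ηX (B.proj y)))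
    have key : ∀ a b : X, a = b → (ζ a : EuclideanSpace ℝ (Fin n)) = ζ b := by
      rintro a _ rfl; rfl
    obtain ⟨L, hL⟩ := η.isInvertible_mfderiv y
    obtain ⟨M, hM⟩ := hX (B.proj y)
    have e := η.inv.proj_mfderiv ηX h y (L.symm (ξ.1 (η.toDiffeo.symm y)))
    have e1 : mfderiv (𝓡 (n + k)) (𝓡 (n + k)) η.inv.toDiffeo y
        (L.symm (ξ.1 (η.toDiffeo.symm y))) =
        ξ.1 (η.toDiffeo.symm y) :=
      (congrArg (fun T => T (L.symm (ξ.1 (η.toDiffeo.symm y)))) hL.symm).trans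
        (L.apply_symm_apply _)
    rw [e1] at e
    have e2 := (hζ (η.toDiffeo.symm y)).symm.trans e
    have e3 := (key _ _ (h y)).symm.trans e2
    rw [← hL, ← hM, ContinuousLinearMap.inverse_equiv, ContinuousLinearMap.inverse_equiv]
    rw [← hM] at e3
    exact (M.symm_apply_eq.2 e3).symm⟩

end Aut

/-- A momentum mapping `J : L_V Y → 𝔤^* ⊗ ℝⁿ⁺ᵏ` for the lifted action of `Aut Y`, with `𝔤` the Lie
algebra of projectable vector fields: the action leaves `i^*dθ` invariant, and
`d(Ĵ ξ) = - ξ_{L_V Y} ⌟ i^*dθ` for all `ξ`, where `Ĵ ξ (w) = ⟨J w, ξ⟩`. -/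
structure IsMomentumMapping (B : SmoothFiberBundle n k X Y F)
    (J : B.LVY → (B.projectable →ₗ[ℝ] RSum n k)) : Prop where
  contMDiff_lift : ∀ η : B.Aut,
    ContMDiff 𝓘(ℝ, FrameModel n k) 𝓘(ℝ, FrameModel n k) ∞ η.lift
  invariant : ∀ (η : B.Aut) (w : B.LVY) (u v : TangentSpace 𝓘(ℝ, FrameModel n k) w),
    B.structureForm (η.lift w)
      (mfderiv 𝓘(ℝ, FrameModel n k) 𝓘(ℝ, FrameModel n k) η.lift w u)
      (mfderiv 𝓘(ℝ, FrameModel n k) 𝓘(ℝ, FrameModel n k) η.lift w v) = B.structureForm w u v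
  contMDiff : ∀ ξ : B.projectable,
    ContMDiff 𝓘(ℝ, FrameModel n k) 𝓘(ℝ, RSum n k) ∞ (fun w => J w ξ)
  hamiltonian : ∀ ξ : B.projectable, B.IsHamiltonianPair (fun w => J w ξ) (B.naturalLift ξ)

/-- `Ad^*`-equivariance: `J (Ad_η⁻¹ ξ) = η_{L_V Y}^* (Ĵ ξ)`, i.e. `J ∘ η_{L_V Y} = Ad^*_{η⁻¹} ∘ J`. -/
def IsAdEquivariant (B : SmoothFiberBundle n k X Y F)
    (J : B.LVY → (B.projectable →ₗ[ℝ] RSum n k)) : Prop :=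
  ∀ (η : B.Aut) (ξ : B.projectable) (w : B.LVY), J w (η.inv.Ad ξ) = J (η.lift w) ξ

end Frames
end SmoothFiberBundle

/-! In an adapted chart of `Y` a frame `w` becomes a pair `(p, W)`, a point and an invertible block
lower triangular matrix, and the soldering form becomes `θ = W⁻¹ dp`. Such matrices form an open
subset of a vector space, so the statements reduce to calculus in `p` and `W`. Write `δp_u`, `δW_u`
for the components of a tangent vector `u` of `L_V Y`, and `v` for the representative of a vector
field `ξ` on `Y`.

Differentiating `W θ = dp` gives `W dθ(u, u') = δW_u' θ(u) - δW_u θ(u')` (`toCLM_structureForm`). If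
a family of local automorphisms has velocity `ξ`, the time derivative at `0` of its spatial
derivative is `Dv`, so the natural lift is `(v, Dv W)` (`exists_lift_curve`). The matrix `Dv W` is
again block triangular because `ξ` is projectable: the first components of `v` depend only on the
base coordinates. It follows that `Ĵ(ξ)(w) = w⁻¹ ξ(y)` (`Jhat_eq`), whence linearity, tensoriality
and equivariance. The Hamilton equation follows by comparing the derivative of `W f = v`, which is
`W df(u) = Dv δp_u - δW_u f`, with the formula for `dθ` (`isHamiltonianPair_Jhat`). The form `dθ` is
invariant because a chart carried along by `η` gives a lifted frame its old coordinates
(`exists_transport`).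

Conversely, for tensorial `f` the vector `w (f w)` depends only on the base point of `w`, and so
defines a vector field `ξ` on `Y`. If `f` also has a Hamiltonian field `Z`, the Hamilton equation at
a coordinate frame `W = 1` reads `Dv a = δW_Z a` for the `u` with `δp_u = a`, `δW_u = 0`. As `δW_Z`
is block triangular, `Dv` maps vertical vectors to vertical vectors
(`fderiv_vecRep_fst_of_hamiltonian`), so the projection of `ξ` to `X` is locally constant along
fibers. On connected fibers it is constant, and `ξ` is projectable. -/

/-! ### Vector fields in a chart -/

section VectorFieldInChart

variable {E E' M : Type*} [NormedAddCommGroup E] [NormedSpace ℝ E]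
  [NormedAddCommGroup E'] [NormedSpace ℝ E'] [TopologicalSpace M] [ChartedSpace E M]

/-- The representation of a vector field in a chart. -/
noncomputable def OpenPartialHomeomorph.vecRep (e : OpenPartialHomeomorph M E')
    (v : ∀ x : M, TangentSpace 𝓘(ℝ, E) x) (p : E') : E' :=
  mfderiv 𝓘(ℝ, E) 𝓘(ℝ, E') e (e.symm p) (v (e.symm p))

lemma OpenPartialHomeomorph.vecRep_apply (e : OpenPartialHomeomorph M E')
    (v : ∀ x : M, TangentSpace 𝓘(ℝ, E) x) {x : M} (hx : x ∈ e.source) :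
    e.vecRep v (e x) = (mfderiv 𝓘(ℝ, E) 𝓘(ℝ, E') e x (v x) : E') := by
  -- The two vectors sit over different expressions for the same point, so they are compared through
  -- their values in `E'`.
  have key : ∀ a b : M, a = b → (mfderiv 𝓘(ℝ, E) 𝓘(ℝ, E') e a (v a) : E') =
      (mfderiv 𝓘(ℝ, E) 𝓘(ℝ, E') e b (v b) : E') := by
    rintro a _ rfl; rfl
  exact key _ _ (e.left_inv hx)

/-- A vector field is smooth at a point exactly when its representation in a chart is. -/
lemma contMDiffAt_section_iff_chart [CompleteSpace E] [CompleteSpace E']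
    [IsManifold 𝓘(ℝ, E) ∞ M] (e : OpenPartialHomeomorph M E')
    (he : ContMDiffOn 𝓘(ℝ, E) 𝓘(ℝ, E') ∞ e e.source)
    (he' : ContMDiffOn 𝓘(ℝ, E') 𝓘(ℝ, E) ∞ e.symm e.target)
    (v : ∀ x : M, TangentSpace 𝓘(ℝ, E) x) {x : M} (hx : x ∈ e.source) :
    ContMDiffAt 𝓘(ℝ, E) (𝓘(ℝ, E).prod 𝓘(ℝ, E)) ∞
      (fun x => (Bundle.TotalSpace.mk' E x (v x) : TangentBundle 𝓘(ℝ, E) M)) x ↔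
    ContDiffAt ℝ ∞ (e.vecRep v) (e x) := by
  have hM : e.MDifferentiable 𝓘(ℝ, E) 𝓘(ℝ, E') :=
    ⟨he.mdifferentiableOn (by simp), he'.mdifferentiableOn (by simp)⟩
  have : IsManifold 𝓘(ℝ, E) 1 M := .of_le (n := ∞) (by simp)
  constructor
  · intro h
    have hp : e x ∈ e.target := e.map_source hx
    have h' := h
    rw [← e.left_inv hx] at h'
    -- The pullback of `v` along `e.symm` is `e.vecRep v`, since the differentials of `e` and
    -- `e.symm` are mutually inverse.
    have h2 := ContMDiffAt.mpullback_vectorField_preimage (f := e.symm) (x₀ := e x) (V := v)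
      (n := ∞) (m := ∞) h' ((he' _ hp).contMDiffAt (e.open_target.mem_nhds hp))
      ⟨hM.symm.mfderiv hp, rfl⟩ (by simp)
    refine contMDiffAt_vectorSpace_iff_contDiffAt.1 ?_
    refine h2.congr_of_eventuallyEq ?_
    filter_upwards [e.open_target.mem_nhds hp] with p hp
    refine congrArg (fun z => (⟨p, z⟩ : TangentBundle 𝓘(ℝ, E') E')) ?_
    rw [VectorField.mpullback_apply]
    have h3 : (mfderiv 𝓘(ℝ, E') 𝓘(ℝ, E) e.symm p) = (hM.symm.mfderiv hp : _ →L[ℝ] _) := rfl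
    rw [h3, ContinuousLinearMap.inverse_equiv]
    refine (ContinuousLinearEquiv.symm_apply_eq _).2 ?_ |>.symm
    have h4 := hM.symm_comp_deriv (e.map_target hp)
    rw [e.right_inv hp] at h4
    exact (congrArg (fun L => L (v (e.symm p))) h4).symm
  · intro h
    -- Conversely, `v` is the pullback of its representative along `e`.
    have h2 := ContMDiffAt.mpullback_vectorField_preimage (f := e) (x₀ := x) (V := e.vecRep v)
      (n := ∞) (m := ∞) (contMDiffAt_vectorSpace_iff_contDiffAt.2 h)
      ((he _ hx).contMDiffAt (e.open_source.mem_nhds hx))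
      ⟨hM.mfderiv hx, rfl⟩ (by simp)
    refine h2.congr_of_eventuallyEq ?_
    filter_upwards [e.open_source.mem_nhds hx] with y hy
    refine congrArg (fun z => (⟨y, z⟩ : TangentBundle 𝓘(ℝ, E) M)) ?_
    have h3 : (mfderiv 𝓘(ℝ, E) 𝓘(ℝ, E') e y) = (hM.mfderiv hy : _ →L[ℝ] _) := rfl
    change v y = (mfderiv 𝓘(ℝ, E) 𝓘(ℝ, E') e y).inverse (e.vecRep v (e y))
    rw [e.vecRep_apply v hy, h3, ContinuousLinearMap.inverse_equiv]
    exact ((hM.mfderiv hy).symm_apply_apply (v y)).symm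

end VectorFieldInChart

/-! ### Block triangular matrices as a linear space of operators -/

namespace BlockTri

variable {n k : ℕ}

/-- `BlockTri.toCLM` as a continuous linear map. -/
noncomputable def toCLML (n k : ℕ) : BlockTri n k →L[ℝ] (RSum n k →L[ℝ] RSum n k) :=
  LinearMap.toContinuousLinearMap
    { toFun := toCLM
      map_add' := fun b b' => by
        refine ContinuousLinearMap.ext fun u => Prod.ext ?_ ?_ <;> simp [toCLM_apply]; abel
      map_smul' := fun c b => by
        refine ContinuousLinearMap.ext fun u => Prod.ext ?_ ?_ <;> simp [toCLM_apply] }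

/-- `BlockTri.ofCLM` as a continuous linear map. -/
noncomputable def ofCLML (n k : ℕ) : (RSum n k →L[ℝ] RSum n k) →L[ℝ] BlockTri n k :=
  LinearMap.toContinuousLinearMap
    { toFun := ofCLM
      map_add' := fun b b' => by
        simp [ofCLM]
      map_smul' := fun c b => by
        simp [ofCLM] }

lemma Inv.isInvertible {b : BlockTri n k} (h : b.Inv) : b.toCLM.IsInvertible :=
  ⟨h.equiv, ContinuousLinearMap.ext h.equiv_apply⟩

lemma inv_ofCLM_id : (ofCLM (ContinuousLinearMap.id ℝ (RSum n k))).Inv :=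
  inv_ofCLM _ (fun _ h => h) fun _ => Iff.rfl

end BlockTri

/-! ### Projectable fields, frame charts and the soldering form in adapted coordinates -/

namespace SmoothFiberBundle

section Charts

variable {n k : ℕ} {X Y F : Type*}
  [TopologicalSpace X] [ChartedSpace (EuclideanSpace ℝ (Fin n)) X]
  [TopologicalSpace Y] [ChartedSpace (EuclideanSpace ℝ (Fin (n + k))) Y]
  [TopologicalSpace F] [ChartedSpace (EuclideanSpace ℝ (Fin k)) F]
  {B : SmoothFiberBundle n k X Y F}

namespace AdaptedChart

variable (φ : B.AdaptedChart)

/-- The first components of the differential of an adapted chart are the differential of the chart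
of the base, applied to the projected vector. -/
lemma deriv_fst {y : Y} (hy : y ∈ φ.total.source) (z : TangentSpace (𝓡 (n + k)) y) :
    (φ.deriv hy z).1 =
      mfderiv (𝓡 n) (𝓡 n) φ.base (B.proj y) (mfderiv (𝓡 (n + k)) (𝓡 n) B.proj y z) := by
  have hb := φ.mdifferentiable_base.mdifferentiableAt (φ.mapsTo y hy)
  have e1 := mfderiv_comp y hb (φ.mdifferentiableAt_proj hy)
  have hf : MDifferentiableAt 𝓘(ℝ, RSum n k) (𝓡 n) (Prod.fst : RSum n k → _) (φ.total y) :=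
    (contDiff_fst (𝕜 := ℝ) (n := 1)).contMDiff.mdifferentiable (by simp) _
  have e2 := mfderiv_comp y hf (φ.mdifferentiable.mdifferentiableAt hy)
  have e3 : (φ.base ∘ B.proj) =ᶠ[𝓝 y] (Prod.fst ∘ φ.total) := by
    filter_upwards [φ.total.open_source.mem_nhds hy] with y' hy'
    exact φ.base_proj y' hy'
  have e4 := e3.mfderiv_eq (I := 𝓡 (n + k)) (I' := 𝓡 n)
  have e5 : mfderiv 𝓘(ℝ, RSum n k) (𝓡 n) (Prod.fst : RSum n k → _) (φ.total y) =
      (ContinuousLinearMap.fst ℝ (EuclideanSpace ℝ (Fin n)) (EuclideanSpace ℝ (Fin k)) :) := by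
    rw [mfderiv_eq_fderiv]; exact fderiv_fst
  have := congrArg (fun L => L z) (e1.symm.trans (e4.trans e2))
  rw [e5] at this
  exact this.symm

lemma fst_mem_target {p : RSum n k} (hp : p ∈ φ.total.target) : p.1 ∈ φ.base.target := by
  have h := φ.base.map_source (φ.mapsTo _ (φ.total.map_target hp))
  rwa [φ.base_proj _ (φ.total.map_target hp), φ.total.right_inv hp] at h

lemma proj_symm {p : RSum n k} (hp : p ∈ φ.total.target) :
    B.proj (φ.total.symm p) = φ.base.symm p.1 := by
  have h := φ.base_proj _ (φ.total.map_target hp)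
  rw [φ.total.right_inv hp] at h
  rw [← h, φ.base.left_inv (φ.mapsTo _ (φ.total.map_target hp))]

lemma contDiffAt_vecRep [IsManifold (𝓡 (n + k)) ∞ Y]
    (ξ : SmoothVectorField (EuclideanSpace ℝ (Fin (n + k))) Y)
    {p : RSum n k} (hp : p ∈ φ.total.target) : ContDiffAt ℝ ∞ (φ.total.vecRep ξ) p := by
  have h := (contMDiffAt_section_iff_chart φ.total φ.contMDiffOn φ.contMDiffOn_symm ξ
    (φ.total.map_target hp)).1 (ξ.contMDiff _)
  rwa [φ.total.right_inv hp] at h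

lemma contDiffAt_vecRep_base [IsManifold (𝓡 n) ∞ X]
    (ζ : SmoothVectorField (EuclideanSpace ℝ (Fin n)) X)
    {x : EuclideanSpace ℝ (Fin n)} (hx : x ∈ φ.base.target) :
    ContDiffAt ℝ ∞ (φ.base.vecRep ζ) x := by
  have h := (contMDiffAt_section_iff_chart φ.base φ.contMDiffOn_base φ.contMDiffOn_base_symm ζ
    (φ.base.map_target hx)).1 (ζ.contMDiff _)
  rwa [φ.base.right_inv hx] at h

/-- Projectability in coordinates: the first components of `ξ` are a function of the base
coordinates alone. No smoothness is assumed, so `exists_proj_related` can use this to prove that `ζ`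
is smooth. -/
lemma vecRep_fst (ξ : ∀ y : Y, TangentSpace (𝓡 (n + k)) y) (ζ : ∀ x : X, TangentSpace (𝓡 n) x)
    (h : ∀ y, mfderiv (𝓡 (n + k)) (𝓡 n) B.proj y (ξ y) = ζ (B.proj y))
    {p : RSum n k} (hp : p ∈ φ.total.target) :
    (φ.total.vecRep ξ p).1 = φ.base.vecRep ζ p.1 := by
  have hy := φ.total.map_target hp
  have h1 := φ.deriv_fst hy (ξ (φ.total.symm p))
  rw [h] at h1
  have h2 := φ.base.vecRep_apply ζ (φ.mapsTo _ hy)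
  rw [φ.base_proj _ hy, φ.total.right_inv hp] at h2
  exact h1.trans h2.symm

/-- By `vecRep_fst` the first components do not change in vertical directions. This is what keeps
the natural lift inside the block triangular matrices. -/
lemma fderiv_vecRep_fst [IsManifold (𝓡 n) ∞ X] [IsManifold (𝓡 (n + k)) ∞ Y]
    (ξ : B.projectable) {p : RSum n k} (hp : p ∈ φ.total.target) {u : RSum n k} (hu : u.1 = 0) :
    (fderiv ℝ (φ.total.vecRep ξ.1) p u).1 = 0 := by
  obtain ⟨ζ, hζ⟩ := ξ.2
  have hd := (φ.contDiffAt_vecRep ξ.1 hp).differentiableAt (by simp)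
  have hb := (φ.contDiffAt_vecRep_base ζ (φ.fst_mem_target hp)).differentiableAt (by simp)
  have h1 : HasFDerivAt (fun q => (φ.total.vecRep ξ.1 q).1) _ p := hd.hasFDerivAt.fst
  have h2 : HasFDerivAt (fun q : RSum n k => φ.base.vecRep ζ q.1) _ p :=
    hb.hasFDerivAt.comp p hasFDerivAt_fst
  have h3 : (fun q => (φ.total.vecRep ξ.1 q).1) =ᶠ[𝓝 p] fun q => φ.base.vecRep ζ q.1 := by
    filter_upwards [φ.total.open_target.mem_nhds hp] with q hq
    exact φ.vecRep_fst ξ.1 ζ hζ hq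
  have h4 := congrArg (fun L => L u) ((h2.congr_of_eventuallyEq h3).unique h1)
  have h5 : (fderiv ℝ (φ.total.vecRep ξ.1) p u).1 =
    fderiv ℝ (φ.base.vecRep ζ) p.1 u.1 := h4.symm
  rw [h5, hu, map_zero]

variable [IsManifold (𝓡 n) ∞ X] [IsManifold (𝓡 k) ∞ F]

/-- The chart of `L_V Y` induced by an adapted chart of `Y`, as an open partial homeomorphism. -/
noncomputable def frameHomeo (w₀ : B.LVY) : OpenPartialHomeomorph B.LVY (FrameModel n k) :=
  (LVY.core B).openPartialHomeomorph (φ.frameChart w₀) ⟨φ, w₀, rfl⟩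

lemma frameHomeo_symm_base (w₀ : B.LVY) {q : FrameModel n k}
    (hq : q ∈ (φ.frameHomeo w₀).target) :
    ((φ.frameHomeo w₀).symm q).base = φ.total.symm q.1 :=
  φ.frameChart_symm_base w₀ hq

lemma frameHomeo_mem_maximalAtlas (w₀ : B.LVY) :
    φ.frameHomeo w₀ ∈ IsManifold.maximalAtlas 𝓘(ℝ, FrameModel n k) ∞ B.LVY :=
  IsManifold.subset_maximalAtlas
    (mem_iUnion₂.2 ⟨φ.frameChart w₀, ⟨φ, w₀, rfl⟩, rfl⟩)

lemma contMDiffOn_frameHomeo (w₀ : B.LVY) :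
    ContMDiffOn 𝓘(ℝ, FrameModel n k) 𝓘(ℝ, FrameModel n k) ∞ (φ.frameHomeo w₀)
      (φ.frameHomeo w₀).source :=
  contMDiffOn_of_mem_maximalAtlas (φ.frameHomeo_mem_maximalAtlas w₀)

lemma contMDiffOn_frameHomeo_symm (w₀ : B.LVY) :
    ContMDiffOn 𝓘(ℝ, FrameModel n k) 𝓘(ℝ, FrameModel n k) ∞ (φ.frameHomeo w₀).symm
      (φ.frameHomeo w₀).target :=
  contMDiffOn_symm_of_mem_maximalAtlas (φ.frameHomeo_mem_maximalAtlas w₀)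

lemma mdifferentiable_frameHomeo (w₀ : B.LVY) :
    (φ.frameHomeo w₀).MDifferentiable 𝓘(ℝ, FrameModel n k) 𝓘(ℝ, FrameModel n k) :=
  ⟨(φ.contMDiffOn_frameHomeo w₀).mdifferentiableOn (by simp),
    (φ.contMDiffOn_frameHomeo_symm w₀).mdifferentiableOn (by simp)⟩

lemma mem_frameHomeo_target_coord {w₀ w : B.LVY} (hw : w.base ∈ φ.total.source) :
    φ.coord w ∈ (φ.frameHomeo w₀).target := (φ.frameHomeo w₀).map_source hw

lemma mdifferentiableAt_coord {w : B.LVY} (hw : w.base ∈ φ.total.source) :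
    MDifferentiableAt 𝓘(ℝ, FrameModel n k) 𝓘(ℝ, FrameModel n k) φ.coord w :=
  (φ.mdifferentiable_frameHomeo w).mdifferentiableAt hw

/-- The coordinates of a tangent vector of `L_V Y` in the chart induced by an adapted chart. -/
noncomputable def tcoord {w : B.LVY} (hw : w.base ∈ φ.total.source) :
    TangentSpace 𝓘(ℝ, FrameModel n k) w ≃L[ℝ] FrameModel n k :=
  (φ.mdifferentiable_frameHomeo w).mfderiv (x := w) hw

lemma eventually_base_mem {w : B.LVY} (hw : w.base ∈ φ.total.source) :
    ∀ᶠ w' in 𝓝 w, w'.base ∈ φ.total.source :=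
  (φ.frameHomeo w).open_source.mem_nhds hw

lemma mfderiv_symm_coord {w₀ w : B.LVY} (hw : w.base ∈ φ.total.source) (q : FrameModel n k) :
    (mfderiv 𝓘(ℝ, FrameModel n k) 𝓘(ℝ, FrameModel n k) (φ.frameHomeo w₀).symm (φ.coord w) q :
      FrameModel n k) = (φ.tcoord hw).symm q := by
  have h := (φ.mdifferentiable_frameHomeo w₀).symm_comp_deriv (x := w) hw
  have h2 := congrArg (fun L => L ((φ.tcoord hw).symm q)) h
  have h3 : mfderiv 𝓘(ℝ, FrameModel n k) 𝓘(ℝ, FrameModel n k) (φ.frameHomeo w₀) w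
    ((φ.tcoord hw).symm q) = q := (φ.tcoord hw).apply_symm_apply q
  refine Eq.trans ?_ h2
  rw [ContinuousLinearMap.comp_apply, h3]
  rfl

end AdaptedChart

variable [IsManifold (𝓡 n) ∞ X] [IsManifold (𝓡 k) ∞ F]

lemma contMDiff_base : ContMDiff 𝓘(ℝ, FrameModel n k) (𝓡 (n + k)) ∞ (fun w : B.LVY => w.base) := by
  intro w
  let φ := B.adaptedChartAt w.base
  have hw : w.base ∈ φ.total.source := B.mem_adaptedChartAt w.base
  have h1 : ContMDiffAt 𝓘(ℝ, FrameModel n k) 𝓘(ℝ, RSum n k) ∞ (fun w' : B.LVY => (φ.coord w').1) w :=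
    contDiff_fst.contMDiff.contMDiffAt.comp w
      ((φ.contMDiffOn_frameHomeo w).contMDiffAt ((φ.frameHomeo w).open_source.mem_nhds hw))
  have h2 : ContMDiffAt 𝓘(ℝ, RSum n k) (𝓡 (n + k)) ∞ φ.total.symm (φ.coord w).1 :=
    φ.contMDiffOn_symm.contMDiffAt (φ.total.open_target.mem_nhds (φ.total.map_source hw))
  refine (h2.comp w h1).congr_of_eventuallyEq ?_
  filter_upwards [φ.eventually_base_mem hw] with w' hw'
  exact (φ.total.left_inv hw').symm

/-- The soldering form in an adapted chart. -/
lemma AdaptedChart.toCLM_soldering (φ : B.AdaptedChart) {w : B.LVY} (hw : w.base ∈ φ.total.source)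
    (Z : TangentSpace 𝓘(ℝ, FrameModel n k) w) :
    (φ.coord w).2.toCLM (B.soldering w Z) = (φ.tcoord hw Z).1 := by
  rw [φ.toCLM_coord w hw]
  -- `w` cancels the `w⁻¹` in the soldering form; what remains is the differential of `w ↦ φ.total
  -- w.base`, the first component of `coord`.
  have h0 : φ.matrix w hw (B.soldering w Z) = φ.deriv hw
      (mfderiv 𝓘(ℝ, FrameModel n k) (𝓡 (n + k)) (fun w : B.LVY => w.base) w Z) :=
    congrArg (φ.deriv hw) (w.frame.apply_symm_apply _)
  refine h0.trans ?_
  have hd : MDifferentiableAt 𝓘(ℝ, FrameModel n k) (𝓡 (n + k)) (fun w : B.LVY => w.base) w :=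
    contMDiff_base.mdifferentiableAt (by simp)
  have h1 := mfderiv_comp w (φ.mdifferentiable.mdifferentiableAt hw) hd
  have hf : MDifferentiableAt 𝓘(ℝ, FrameModel n k) 𝓘(ℝ, RSum n k)
      (Prod.fst : FrameModel n k → RSum n k) (φ.coord w) :=
    (contDiff_fst (𝕜 := ℝ) (n := 1)).contMDiff.mdifferentiable (by simp) _
  have h2 := mfderiv_comp w hf (φ.mdifferentiableAt_coord hw)
  have h3 : mfderiv 𝓘(ℝ, FrameModel n k) 𝓘(ℝ, RSum n k)
      (Prod.fst : FrameModel n k → RSum n k) (φ.coord w) =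
      (ContinuousLinearMap.fst ℝ (RSum n k) (BlockTri n k) :) := by
    rw [mfderiv_eq_fderiv]; exact fderiv_fst
  rw [h3] at h2
  exact congrArg (fun L => L Z) (h1.symm.trans h2)

end Charts

end SmoothFiberBundle

/-! ### Exterior derivatives, and the derivative of the soldering form in coordinates -/

/-- The exterior derivative of a one-form given by a function into the continuous linear maps. -/
lemma extDeriv_ofSubsingleton_apply {E V : Type*} [NormedAddCommGroup E] [NormedSpace ℝ E]
    [NormedAddCommGroup V] [NormedSpace ℝ V] {G : E → E →L[ℝ] V} {x : E}
    (hG : DifferentiableAt ℝ G x) (u v : E) :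
    extDeriv (fun p => ContinuousAlternatingMap.ofSubsingleton ℝ E V (0 : Fin 1) (G p)) x ![u, v] =
      fderiv ℝ G x u v - fderiv ℝ G x v u := by
  have hd : DifferentiableAt ℝ
      (fun p => ContinuousAlternatingMap.ofSubsingleton ℝ E V (0 : Fin 1) (G p)) x :=
    (ContinuousAlternatingMap.ofSubsingletonLIE (𝕜 := ℝ) (E := E) (F := V)
      (0 : Fin 1)).differentiable.differentiableAt.comp x hG
  have h : ∀ a b : E, fderiv ℝ (fun p => G p b) x a = fderiv ℝ G x a b := fun a b => by
    have := (hG.hasFDerivAt.clm_apply (hasFDerivAt_const b x)).fderiv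
    rw [this]; simp
  rw [extDeriv_apply hd, Fin.sum_univ_two, ← h, ← h]
  simp [Fin.removeNth, ← sub_eq_add_neg]

section Calculus

variable {E V V' V'' : Type*} [NormedAddCommGroup E] [NormedSpace ℝ E]
  [NormedAddCommGroup V] [NormedSpace ℝ V] [NormedAddCommGroup V'] [NormedSpace ℝ V']
  [NormedAddCommGroup V''] [NormedSpace ℝ V'']

lemma fderiv_clm_apply_vec {G : E → V →L[ℝ] V'} {x : E} (hG : DifferentiableAt ℝ G x) (v : V) :
    HasFDerivAt (fun q => G q v) ((fderiv ℝ G x).flip v) x := by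
  simpa using hG.hasFDerivAt.clm_apply (hasFDerivAt_const v x)

/-- Differentiation of a right inverse `G` of `L`: if `L G v` is constant, then
`L (G' v) = - L' (G v)`. -/
lemma apply_fderiv_of_eventually_const {L : E → V' →L[ℝ] V''} {L' : E →L[ℝ] V' →L[ℝ] V''}
    {G : E → V →L[ℝ] V'} {x : E} (hL : HasFDerivAt L L' x) (hG : DifferentiableAt ℝ G x) {v : V}
    {c : V''} (h : ∀ᶠ q in 𝓝 x, L q (G q v) = c) (δ : E) :
    L x (fderiv ℝ G x δ v) = - L' δ (G x v) := by
  have h3 := hL.clm_apply (fderiv_clm_apply_vec hG v)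
  have h4 : (fun q => L q (G q v)) =ᶠ[𝓝 x] fun _ => c := h
  have h5 := (h3.congr_of_eventuallyEq h4.symm).unique (hasFDerivAt_const c x)
  have h6 := congrArg (fun L => L δ) h5
  exact eq_neg_of_add_eq_zero_left h6

lemma HasFDerivAt.exists_clm_comp {L : E → V' →L[ℝ] V''} {L' : E →L[ℝ] V' →L[ℝ] V''}
    {G : E → V →L[ℝ] V'} {G' : E →L[ℝ] V →L[ℝ] V'} {x : E} (hL : HasFDerivAt L L' x)
    (hG : HasFDerivAt G G' x) :
    ∃ D : E →L[ℝ] V →L[ℝ] V'', HasFDerivAt (fun q => L q ∘L G q) D x ∧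
      ∀ δ a, D δ a = L' δ (G x a) + L x (G' δ a) :=
  ⟨_, hL.clm_comp hG, fun δ a => by simp [add_comm]⟩

lemma ContDiffAt.fderiv_fderiv_symm {f : E → V} {x : E} (hf : ContDiffAt ℝ ∞ f x) (u v : E) :
    fderiv ℝ (fderiv ℝ f) x u v = fderiv ℝ (fderiv ℝ f) x v u :=
  (hf.isSymmSndFDerivAt (by
    rw [minSmoothness_of_isRCLikeNormedField]; exact WithTop.coe_le_coe.2 le_top)).eq u v

end Calculus

namespace BlockTri

variable {n k : ℕ}

/-- The soldering form in the coordinates of the frame bundle. -/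
noncomputable def solderForm (q : FrameModel n k) : FrameModel n k →L[ℝ] RSum n k :=
  q.2.toCLM.inverse ∘L ContinuousLinearMap.fst ℝ _ _

lemma contDiffAt_inverse_toCLM {b : BlockTri n k} (hb : b.Inv) :
    ContDiffAt ℝ ∞ (fun b : BlockTri n k => b.toCLM.inverse) b :=
  (hb.isInvertible.contDiffAt_map_inverse).comp b contDiff_toCLM.contDiffAt

lemma differentiableAt_solderForm {q : FrameModel n k} (hq : q.2.Inv) :
    DifferentiableAt ℝ solderForm q := by
  have h : ContDiffAt ℝ ∞ (fun q : FrameModel n k => q.2.toCLM.inverse) q :=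
    (contDiffAt_inverse_toCLM hq).comp q contDiffAt_snd
  exact (h.differentiableAt (by simp)).clm_comp (differentiableAt_const _)

/-- Differentiate `W θ(v) = v.1` with `v` fixed; the right side is constant, so no formula for the
derivative of `W⁻¹` is needed. -/
lemma toCLM_fderiv_solderForm {q : FrameModel n k} (hq : q.2.Inv) (δ v : FrameModel n k) :
    q.2.toCLM (fderiv ℝ solderForm q δ v) = - δ.2.toCLM (solderForm q v) := by
  refine apply_fderiv_of_eventually_const (L := fun q : FrameModel n k => q.2.toCLM)
    (toCLML n k ∘L ContinuousLinearMap.snd ℝ (RSum n k) _).hasFDerivAt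
    (differentiableAt_solderForm hq) (c := v.1) ?_ δ
  filter_upwards [(isOpen_setOf_inv.preimage continuous_snd).mem_nhds hq] with q' hq'
  exact (Inv.isInvertible hq').self_apply_inverse _

end BlockTri

/-! ### Change of adapted chart, and the structure form in any adapted chart -/

namespace SmoothFiberBundle

section Charts

variable {n k : ℕ} {X Y F : Type*}
  [TopologicalSpace X] [ChartedSpace (EuclideanSpace ℝ (Fin n)) X]
  [TopologicalSpace Y] [ChartedSpace (EuclideanSpace ℝ (Fin (n + k))) Y]
  [TopologicalSpace F] [ChartedSpace (EuclideanSpace ℝ (Fin k)) F]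
  {B : SmoothFiberBundle n k X Y F}

namespace AdaptedChart

variable (φ φ' : B.AdaptedChart)

lemma contDiffAt_change {p : RSum n k} (hp : p ∈ (φ.total.symm.trans φ'.total).source) :
    ContDiffAt ℝ ∞ (φ'.total ∘ φ.total.symm) p := by
  have h : ContDiffOn ℝ ∞ (φ'.total ∘ φ.total.symm) (φ.total.symm.trans φ'.total).source := by
    rw [← contMDiffOn_iff_contDiffOn]
    exact φ'.contMDiffOn.comp (φ.contMDiffOn_symm.mono fun p hp => hp.1) fun p hp => hp.2
  exact h.contDiffAt ((φ.total.symm.trans φ'.total).open_source.mem_nhds hp)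

lemma mem_change_source {B : SmoothFiberBundle n k X Y F} {φ φ' : B.AdaptedChart} {y : Y}
    (hy : y ∈ φ.total.source) (hy' : y ∈ φ'.total.source) :
    φ.total y ∈ (φ.total.symm.trans φ'.total).source := by
  refine ⟨φ.total.map_source hy, ?_⟩
  change φ.total.symm (φ.total y) ∈ φ'.total.source
  rwa [φ.total.left_inv hy]

/-- The differentials of two charts are related by the Jacobian of the transition map. -/
lemma deriv_change {y : Y} (hy : y ∈ φ.total.source) (hy' : y ∈ φ'.total.source)
    (z : TangentSpace (𝓡 (n + k)) y) :
    φ'.deriv hy' z = fderiv ℝ (φ'.total ∘ φ.total.symm) (φ.total y) (φ.deriv hy z) := by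
  have hτ : MDifferentiableAt 𝓘(ℝ, RSum n k) 𝓘(ℝ, RSum n k) (φ'.total ∘ φ.total.symm)
      (φ.total y) :=
    ((φ.contDiffAt_change φ' (mem_change_source hy hy')).differentiableAt
      (by simp)).mdifferentiableAt
  have h1 := mfderiv_comp y hτ (φ.mdifferentiable.mdifferentiableAt hy)
  have h2 : ((φ'.total ∘ φ.total.symm) ∘ φ.total) =ᶠ[𝓝 y] φ'.total := by
    filter_upwards [φ.total.open_source.mem_nhds hy] with y hy
    simp only [Function.comp, φ.total.left_inv hy]
  have h3 := h2.mfderiv_eq (I := 𝓡 (n + k)) (I' := 𝓘(ℝ, RSum n k))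
  rw [mfderiv_eq_fderiv] at h1
  exact congrArg (fun L => L z) (h3.symm.trans h1)

lemma toCLM_coord_change {w : B.LVY} (hw : w.base ∈ φ.total.source)
    (hw' : w.base ∈ φ'.total.source) :
    (φ'.coord w).2.toCLM =
      fderiv ℝ (φ'.total ∘ φ.total.symm) (φ.coord w).1 ∘L (φ.coord w).2.toCLM := by
  rw [φ.toCLM_coord w hw, φ'.toCLM_coord w hw']
  exact ContinuousLinearMap.ext fun u => φ.deriv_change φ' hw hw' (w.frame u)

variable [IsManifold (𝓡 n) ∞ X] [IsManifold (𝓡 k) ∞ F]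

lemma mfderiv_comp_coord {V : Type*} [NormedAddCommGroup V] [NormedSpace ℝ V] {w : B.LVY}
    (hw : w.base ∈ φ.total.source) {f : FrameModel n k → V} {f' : FrameModel n k →L[ℝ] V}
    (hf : HasFDerivAt f f' (φ.coord w)) (Z : TangentSpace 𝓘(ℝ, FrameModel n k) w) :
    (mfderiv 𝓘(ℝ, FrameModel n k) 𝓘(ℝ, V) (fun v => f (φ.coord v)) w Z : V) =
      f' (φ.tcoord hw Z) :=
  congrArg (fun L => L Z)
    (hf.hasMFDerivAt.comp w (φ.mdifferentiableAt_coord hw).hasMFDerivAt).mfderiv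

/-- One function on `L_V Y`, written in two charts, has one differential. Taking for `f` the
components of the coordinates yields their transformation rules. -/
lemma tcoord_eq {V : Type*} [NormedAddCommGroup V] [NormedSpace ℝ V] {w : B.LVY}
    (hw : w.base ∈ φ.total.source) (hw' : w.base ∈ φ'.total.source)
    {f g : FrameModel n k → V} {f' g' : FrameModel n k →L[ℝ] V}
    (h : ∀ᶠ v in 𝓝 w, f (φ'.coord v) = g (φ.coord v))
    (hf : HasFDerivAt f f' (φ'.coord w)) (hg : HasFDerivAt g g' (φ.coord w))
    (Z : TangentSpace 𝓘(ℝ, FrameModel n k) w) :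
    f' (φ'.tcoord hw' Z) = g' (φ.tcoord hw Z) := by
  rw [← φ.mfderiv_comp_coord hw hg, ← φ'.mfderiv_comp_coord hw' hf]
  have h' : (fun v => f (φ'.coord v)) =ᶠ[𝓝 w] fun v => g (φ.coord v) := h
  exact congrArg (fun L => L Z)
    (h'.mfderiv_eq (I := 𝓘(ℝ, FrameModel n k)) (I' := 𝓘(ℝ, V)))

/-- The coordinates of a tangent vector of `L_V Y` in two charts. -/
lemma tcoord_change {w : B.LVY} (hw : w.base ∈ φ.total.source)
    (hw' : w.base ∈ φ'.total.source) (Z : TangentSpace 𝓘(ℝ, FrameModel n k) w) :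
    (φ'.tcoord hw' Z).1 =
      fderiv ℝ (φ'.total ∘ φ.total.symm) (φ.coord w).1 (φ.tcoord hw Z).1 ∧
    ∀ a, (φ'.tcoord hw' Z).2.toCLM a =
      fderiv ℝ (fderiv ℝ (φ'.total ∘ φ.total.symm)) (φ.coord w).1 (φ.tcoord hw Z).1
        ((φ.coord w).2.toCLM a) +
      fderiv ℝ (φ'.total ∘ φ.total.symm) (φ.coord w).1 ((φ.tcoord hw Z).2.toCLM a) := by
  set τ := φ'.total ∘ φ.total.symm with hτdef
  set q := φ.coord w with hq
  have hτ : ContDiffAt ℝ ∞ τ q.1 := φ.contDiffAt_change φ' (mem_change_source hw hw')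
  have hτ1 : DifferentiableAt ℝ τ q.1 := hτ.differentiableAt (by simp)
  have hτ2 : DifferentiableAt ℝ (fderiv ℝ τ) q.1 :=
    (hτ.fderiv_right (m := ∞) (by simp)).differentiableAt (by simp)
  have hA : HasFDerivAt (fun q : FrameModel n k => τ q.1)
      (fderiv ℝ τ q.1 ∘L ContinuousLinearMap.fst ℝ _ _) q :=
    hτ1.hasFDerivAt.comp q hasFDerivAt_fst
  have hB1 : HasFDerivAt (fun q : FrameModel n k => fderiv ℝ τ q.1)
      (fderiv ℝ (fderiv ℝ τ) q.1 ∘L ContinuousLinearMap.fst ℝ _ _) q :=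
    hτ2.hasFDerivAt.comp q hasFDerivAt_fst
  have hB2 : HasFDerivAt (fun q : FrameModel n k => q.2.toCLM)
      (BlockTri.toCLML n k ∘L ContinuousLinearMap.snd ℝ _ _) q :=
    (BlockTri.toCLML n k ∘L ContinuousLinearMap.snd ℝ (RSum n k) _).hasFDerivAt
  constructor
  · refine φ.tcoord_eq φ' hw hw' ?_ hasFDerivAt_fst hA Z
    filter_upwards [φ.eventually_base_mem hw] with v hv
    exact congrArg φ'.total (φ.total.left_inv hv).symm
  · intro a
    -- Product rule for `W' = Dτ(p) W`; this is where the second derivative of the transition map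
    -- `τ` enters.
    obtain ⟨D, hD, hD'⟩ := hB1.exists_clm_comp hB2
    have h := φ.tcoord_eq φ' hw hw' ?_
      (BlockTri.toCLML n k ∘L ContinuousLinearMap.snd ℝ (RSum n k) _).hasFDerivAt hD Z
    · exact (congrArg (fun L => L a) h).trans (hD' _ a)
    · filter_upwards [φ.eventually_base_mem hw, φ'.eventually_base_mem hw'] with v hv hv'
      exact φ.toCLM_coord_change φ' hv hv'

end AdaptedChart

variable [IsManifold (𝓡 n) ∞ X] [IsManifold (𝓡 k) ∞ F]

lemma structureForm_eq (w : B.LVY) (u v : TangentSpace 𝓘(ℝ, FrameModel n k) w) :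
    B.structureForm w u v =
      fderiv ℝ BlockTri.solderForm ((B.adaptedChartAt w.base).coord w)
        ((B.adaptedChartAt w.base).tcoord (B.mem_adaptedChartAt w.base) u)
        ((B.adaptedChartAt w.base).tcoord (B.mem_adaptedChartAt w.base) v) -
      fderiv ℝ BlockTri.solderForm ((B.adaptedChartAt w.base).coord w)
        ((B.adaptedChartAt w.base).tcoord (B.mem_adaptedChartAt w.base) v)
        ((B.adaptedChartAt w.base).tcoord (B.mem_adaptedChartAt w.base) u) := by
  set φ := B.adaptedChartAt w.base with hφ
  have hw : w.base ∈ φ.total.source := B.mem_adaptedChartAt w.base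
  rw [← extDeriv_ofSubsingleton_apply
    (BlockTri.differentiableAt_solderForm (φ.inv_coord w hw))]
  -- The soldering form pulled back by the frame chart agrees with `solderForm` near the point, and
  -- the exterior derivative depends only on the germ.
  have key : ∀ᶠ q in 𝓝 (φ.coord w),
      (B.soldering ((φ.frameHomeo w).symm q) ∘L
        (mfderiv 𝓘(ℝ, FrameModel n k) 𝓘(ℝ, FrameModel n k) (φ.frameHomeo w).symm q :) :
        FrameModel n k →L[ℝ] RSum n k) = BlockTri.solderForm q := by
    filter_upwards [(φ.frameHomeo w).open_target.mem_nhds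
      (φ.mem_frameHomeo_target_coord hw)] with q hq
    refine ContinuousLinearMap.ext fun z => ?_
    have hs : ((φ.frameHomeo w).symm q).base ∈ φ.total.source := (φ.frameHomeo w).map_target hq
    have hc : φ.coord ((φ.frameHomeo w).symm q) = q := (φ.frameHomeo w).right_inv hq
    have h1 := φ.toCLM_soldering hs
      (mfderiv 𝓘(ℝ, FrameModel n k) 𝓘(ℝ, FrameModel n k) (φ.frameHomeo w).symm q z)
    have h2 : φ.tcoord hs (mfderiv 𝓘(ℝ, FrameModel n k) 𝓘(ℝ, FrameModel n k)
        (φ.frameHomeo w).symm q z) = z :=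
      congrArg (fun L => L z) ((φ.mdifferentiable_frameHomeo w).comp_symm_deriv hq)
    rw [h2, hc] at h1
    exact ((BlockTri.Inv.isInvertible hq.2).inverse_apply_eq.2 h1.symm).symm
  have key2 := key.mono fun q hq =>
    congrArg (ContinuousAlternatingMap.ofSubsingleton ℝ (FrameModel n k) (RSum n k) (0 : Fin 1)) hq
  -- The preferred chart of `L_V Y` at `w` is by definition the frame chart of `adaptedChartAt
  -- w.base`, so `oneFormExtDeriv` is already taken in the right coordinates.
  exact congrArg (fun L => L ![φ.tcoord hw u, φ.tcoord hw v]) (EventuallyEq.extDeriv_eq key2)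

namespace AdaptedChart

variable (φ φ' : B.AdaptedChart)

lemma toCLM_structureForm_adaptedChartAt {w : B.LVY}
    (h0 : w.base ∈ (B.adaptedChartAt w.base).total.source)
    (u v : TangentSpace 𝓘(ℝ, FrameModel n k) w) :
    ((B.adaptedChartAt w.base).coord w).2.toCLM (B.structureForm w u v) =
      ((B.adaptedChartAt w.base).tcoord h0 v).2.toCLM (B.soldering w u) -
        ((B.adaptedChartAt w.base).tcoord h0 u).2.toCLM (B.soldering w v) := by
  have hI := (B.adaptedChartAt w.base).inv_coord w h0
  have hs : ∀ u : TangentSpace 𝓘(ℝ, FrameModel n k) w,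
      BlockTri.solderForm ((B.adaptedChartAt w.base).coord w)
        ((B.adaptedChartAt w.base).tcoord h0 u) = B.soldering w u := fun u =>
    hI.isInvertible.inverse_apply_eq.2 ((B.adaptedChartAt w.base).toCLM_soldering h0 u).symm
  rw [structureForm_eq, map_sub, BlockTri.toCLM_fderiv_solderForm hI,
    BlockTri.toCLM_fderiv_solderForm hI, hs, hs]
  abel

/-- The structure form in an adapted chart. -/
lemma toCLM_structureForm {w : B.LVY} (hw : w.base ∈ φ'.total.source)
    (u v : TangentSpace 𝓘(ℝ, FrameModel n k) w) :
    (φ'.coord w).2.toCLM (B.structureForm w u v) =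
      (φ'.tcoord hw v).2.toCLM (B.soldering w u) -
        (φ'.tcoord hw u).2.toCLM (B.soldering w v) := by
  obtain ⟨φ, h0, h1⟩ : ∃ (φ : B.AdaptedChart) (h0 : w.base ∈ φ.total.source),
      (φ.coord w).2.toCLM (B.structureForm w u v) =
        (φ.tcoord h0 v).2.toCLM (B.soldering w u) - (φ.tcoord h0 u).2.toCLM (B.soldering w v) :=
    ⟨_, _, toCLM_structureForm_adaptedChartAt (B.mem_adaptedChartAt w.base) u v⟩
  obtain ⟨-, hu⟩ := φ.tcoord_change φ' h0 hw u
  obtain ⟨-, hv⟩ := φ.tcoord_change φ' h0 hw v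
  have hτ := φ.contDiffAt_change φ' (mem_change_source h0 hw)
  have hsu := φ.toCLM_soldering h0 u
  have hsv := φ.toCLM_soldering h0 v
  -- The changes of `δW_u` and `δW_v` contribute `D²τ(δp_v, δp_u) - D²τ(δp_u, δp_v) = 0`. This
  -- cancellation makes the formula independent of the chart.
  have hsym := hτ.fderiv_fderiv_symm (φ.tcoord h0 u).1 (φ.tcoord h0 v).1
  have hc := congrArg (fun L => L (B.structureForm w u v)) (φ.toCLM_coord_change φ' h0 hw)
  refine hc.trans ?_
  rw [hu, hv, hsu, hsv]
  have h2 := congrArg (fderiv ℝ (φ'.total ∘ φ.total.symm) (φ.coord w).1) h1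
  refine h2.trans ((map_sub _ _ _).trans ?_)
  have alg : ∀ {x y s t : RSum n k}, s = t → x - y = t + x - (s + y) := by
    rintro x y s _ rfl
    abel
  exact alg hsym

end AdaptedChart

end Charts

end SmoothFiberBundle

/-! ### Invariance of the structure form under bundle automorphisms -/

namespace SmoothFiberBundle

section Charts

variable {n k : ℕ} {X Y F : Type*}
  [TopologicalSpace X] [ChartedSpace (EuclideanSpace ℝ (Fin n)) X]
  [TopologicalSpace Y] [ChartedSpace (EuclideanSpace ℝ (Fin (n + k))) Y]
  [TopologicalSpace F] [ChartedSpace (EuclideanSpace ℝ (Fin k)) F]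
  {B : SmoothFiberBundle n k X Y F}

namespace AdaptedChart

variable (φ : B.AdaptedChart)

/-- The adapted chart `φ ∘ η⁻¹`, where `η` is a bundle automorphism over `ηX`. -/
noncomputable def transport (η : Y ≃ₘ^∞⟮𝓡 (n + k), 𝓡 (n + k)⟯ Y) (ηX : X ≃ₘ^∞⟮𝓡 n, 𝓡 n⟯ X)
    (h : ∀ y, B.proj (η y) = ηX (B.proj y)) : B.AdaptedChart where
  total := η.symm.toHomeomorph.toOpenPartialHomeomorph.trans φ.total
  base := ηX.symm.toHomeomorph.toOpenPartialHomeomorph.trans φ.base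
  contMDiffOn := φ.contMDiffOn.comp η.symm.contMDiff.contMDiffOn fun _ hy => hy.2
  contMDiffOn_symm := η.contMDiff.comp_contMDiffOn
    (φ.contMDiffOn_symm.mono fun _ hp => hp.1)
  contMDiffOn_base := φ.contMDiffOn_base.comp ηX.symm.contMDiff.contMDiffOn fun _ hy => hy.2
  contMDiffOn_base_symm := ηX.contMDiff.comp_contMDiffOn
    (φ.contMDiffOn_base_symm.mono fun _ hp => hp.1)
  mapsTo y hy := by
    have hp : ηX.symm (B.proj y) = B.proj (η.symm y) := ηX.toEquiv.symm_apply_eq.2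
      ((congrArg B.proj (η.apply_symm_apply y)).symm.trans (h (η.symm y)))
    refine ⟨trivial, ?_⟩
    change ηX.symm (B.proj y) ∈ φ.base.source
    rw [hp]
    exact φ.mapsTo _ hy.2
  base_proj y hy := by
    have hp : ηX.symm (B.proj y) = B.proj (η.symm y) := ηX.toEquiv.symm_apply_eq.2
      ((congrArg B.proj (η.apply_symm_apply y)).symm.trans (h (η.symm y)))
    exact (congrArg φ.base hp).trans (φ.base_proj _ hy.2)

end AdaptedChart

variable [IsManifold (𝓡 n) ∞ X] [IsManifold (𝓡 k) ∞ F]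

/-- A bundle automorphism carries adapted charts to adapted charts, and the coordinates of lifted
frames do not change. -/
lemma AdaptedChart.exists_transport (φ : B.AdaptedChart) (η : B.Aut) : ∃ φ' : B.AdaptedChart,
    ∀ w : B.LVY, w.base ∈ φ.total.source →
      (η.lift w).base ∈ φ'.total.source ∧ φ'.coord (η.lift w) = φ.coord w := by
  obtain ⟨ηX, h⟩ := η.covers
  refine ⟨φ.transport η.toDiffeo ηX h, fun w hw => ?_⟩
  have hmem : (η.lift w).base ∈ (φ.transport η.toDiffeo ηX h).total.source := by
    refine ⟨trivial, ?_⟩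
    change η.toDiffeo.symm (η.toDiffeo w.base) ∈ φ.total.source
    rwa [η.toDiffeo.symm_apply_apply]
  refine ⟨hmem, Prod.ext ?_ ?_⟩
  · exact congrArg φ.total (η.toDiffeo.symm_apply_apply w.base)
  · refine congrArg BlockTri.ofCLM (ContinuousLinearMap.ext fun u => ?_)
    have h1 := mfderiv_comp w.base
      ((φ.transport η.toDiffeo ηX h).mdifferentiable.mdifferentiableAt hmem)
      (η.toDiffeo.mdifferentiable (by simp) w.base)
    -- `(φ ∘ η⁻¹) ∘ η = φ`, so by the chain rule the new chart sends `dη (w u)` to what `φ` makes of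
    -- `w u`.
    have h2 : (φ.transport η.toDiffeo ηX h).total ∘ η.toDiffeo.toEquiv.1 = φ.total :=
      funext fun y => congrArg φ.total (η.toDiffeo.symm_apply_apply y)
    rw [h2] at h1
    exact congrArg (fun L => L (w.frame u)) h1.symm

namespace Aut

/-- In the frame charts of `φ` and of its transport the lift is the identity in coordinates. -/
lemma contMDiff_lift (η : B.Aut) :
    ContMDiff 𝓘(ℝ, FrameModel n k) 𝓘(ℝ, FrameModel n k) ∞ η.lift := by
  intro w
  obtain ⟨φ', h⟩ := (B.adaptedChartAt w.base).exists_transport η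
  set φ := B.adaptedChartAt w.base
  have hw : w.base ∈ φ.total.source := B.mem_adaptedChartAt w.base
  have h1 := (φ.contMDiffOn_frameHomeo w).contMDiffAt ((φ.frameHomeo w).open_source.mem_nhds hw)
  have ht : φ.coord w ∈ (φ'.frameHomeo w).target := by
    rw [← (h w hw).2]
    exact φ'.mem_frameHomeo_target_coord (h w hw).1
  have h2 := (φ'.contMDiffOn_frameHomeo_symm w).contMDiffAt
    ((φ'.frameHomeo w).open_target.mem_nhds ht)
  refine (ContMDiffAt.comp w h2 h1).congr_of_eventuallyEq ?_
  filter_upwards [φ.eventually_base_mem hw] with v hv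
  refine ((φ'.frameHomeo w).left_inv (h v hv).1).symm.trans ?_
  exact congrArg (φ'.frameHomeo w).symm (h v hv).2

/-- Coordinates of frames, coordinates of tangent vectors and values of `θ` are all unchanged
between `φ` and its transport, and by `toCLM_structureForm` they determine `dθ`. -/
lemma structureForm_lift (η : B.Aut) (w : B.LVY) (u v : TangentSpace 𝓘(ℝ, FrameModel n k) w) :
    B.structureForm (η.lift w)
      (mfderiv 𝓘(ℝ, FrameModel n k) 𝓘(ℝ, FrameModel n k) η.lift w u)
      (mfderiv 𝓘(ℝ, FrameModel n k) 𝓘(ℝ, FrameModel n k) η.lift w v) = B.structureForm w u v := by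
  obtain ⟨φ', h⟩ := (B.adaptedChartAt w.base).exists_transport η
  set φ := B.adaptedChartAt w.base
  have hw : w.base ∈ φ.total.source := B.mem_adaptedChartAt w.base
  have hw' := (h w hw).1
  have hd := η.contMDiff_lift.mdifferentiableAt (x := w) (by simp)
  have h1 := mfderiv_comp w (φ'.mdifferentiableAt_coord hw') hd
  have h2 : φ'.coord ∘ η.lift =ᶠ[𝓝 w] φ.coord := by
    filter_upwards [φ.eventually_base_mem hw] with v hv
    exact (h v hv).2
  have ht : ∀ u : TangentSpace 𝓘(ℝ, FrameModel n k) w, φ'.tcoord hw'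
      (mfderiv 𝓘(ℝ, FrameModel n k) 𝓘(ℝ, FrameModel n k) η.lift w u) = φ.tcoord hw u := fun u =>
    congrArg (fun L => L u) (h1.symm.trans
      (h2.mfderiv_eq (I := 𝓘(ℝ, FrameModel n k)) (I' := 𝓘(ℝ, FrameModel n k))))
  have hinj : ∀ a b, (φ.coord w).2.toCLM a = (φ.coord w).2.toCLM b → a = b := fun a b hab => by
    rw [φ.toCLM_coord w hw] at hab
    exact (φ.matrix w hw).injective hab
  have hs : ∀ u : TangentSpace 𝓘(ℝ, FrameModel n k) w, B.soldering (η.lift w)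
      (mfderiv 𝓘(ℝ, FrameModel n k) 𝓘(ℝ, FrameModel n k) η.lift w u) = B.soldering w u := by
    intro u
    have h3 := φ'.toCLM_soldering hw'
      (mfderiv 𝓘(ℝ, FrameModel n k) 𝓘(ℝ, FrameModel n k) η.lift w u)
    rw [ht, (h w hw).2, ← φ.toCLM_soldering hw u] at h3
    exact hinj _ _ h3
  have h4 := φ'.toCLM_structureForm hw'
    (mfderiv 𝓘(ℝ, FrameModel n k) 𝓘(ℝ, FrameModel n k) η.lift w u)
    (mfderiv 𝓘(ℝ, FrameModel n k) 𝓘(ℝ, FrameModel n k) η.lift w v)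
  rw [ht, ht, hs, hs, (h w hw).2, ← φ.toCLM_structureForm hw u v] at h4
  exact hinj _ _ h4

end Aut

end Charts

end SmoothFiberBundle

/-! ### The linearization of a one-parameter family of maps -/

section Calculus

variable {V : Type*} [NormedAddCommGroup V] [NormedSpace ℝ V]

/-- For a one-parameter family `Ψ` of maps with `Ψ₀ = id` and velocity `v` at time `0`, the spatial
derivative of `Ψ` is the identity at time `0`, and its time derivative is the derivative of `v`. -/
lemma hasDerivAt_fderiv_of_family {Ψ : ℝ × V → V} {v : V → V} {p₀ : V}
    (hΨ : ContDiffAt ℝ ∞ Ψ (0, p₀)) (h0 : ∀ᶠ p in 𝓝 p₀, Ψ (0, p) = p)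
    (hv : ∀ᶠ p in 𝓝 p₀, HasDerivAt (fun t => Ψ (t, p)) (v p) 0)
    (hd : DifferentiableAt ℝ v p₀) :
    fderiv ℝ (fun p => Ψ (0, p)) p₀ = ContinuousLinearMap.id ℝ V ∧
    HasDerivAt (fun t => fderiv ℝ (fun p => Ψ (t, p)) p₀) (fderiv ℝ v p₀) 0 := by
  have h0' : (fun p => Ψ (0, p)) =ᶠ[𝓝 p₀] id := h0
  refine ⟨by rw [h0'.fderiv_eq, fderiv_id], ?_⟩
  have hdiff : ∀ᶠ q in 𝓝 ((0 : ℝ), p₀), DifferentiableAt ℝ Ψ q :=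
    ((hΨ.of_le (m := 1) (WithTop.coe_le_coe.2 le_top)).eventually (by simp)).mono fun q hq =>
      hq.differentiableAt (by simp)
  have hinr : ∀ (t : ℝ) (p : V), HasFDerivAt (fun p : V => (t, p))
      (ContinuousLinearMap.inr ℝ ℝ V) p := fun t p => hasFDerivAt_prodMk_right t p
  have hinl : ∀ (t : ℝ) (p : V), HasDerivAt (fun t : ℝ => (t, p)) ((1 : ℝ), (0 : V)) t :=
    fun t p => (hasDerivAt_id t).prodMk (hasDerivAt_const t p)
  have hct : Tendsto (fun t : ℝ => (t, p₀)) (𝓝 0) (𝓝 (0, p₀)) :=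
    Continuous.tendsto (by fun_prop) 0
  have hcp : Tendsto (fun p : V => ((0 : ℝ), p)) (𝓝 p₀) (𝓝 (0, p₀)) :=
    Continuous.tendsto (by fun_prop) p₀
  have h1 : (fun t => fderiv ℝ (fun p => Ψ (t, p)) p₀) =ᶠ[𝓝 0]
      fun t => fderiv ℝ Ψ (t, p₀) ∘L ContinuousLinearMap.inr ℝ ℝ V := by
    filter_upwards [hct.eventually hdiff] with t ht
    exact (ht.hasFDerivAt.comp p₀ (hinr t p₀)).fderiv
  have hd2 : DifferentiableAt ℝ (fderiv ℝ Ψ) (0, p₀) :=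
    (hΨ.fderiv_right (m := ∞) (by simp)).differentiableAt (by simp)
  have h2 : HasDerivAt (fun t => fderiv ℝ Ψ (t, p₀)) (fderiv ℝ (fderiv ℝ Ψ) (0, p₀) (1, 0)) 0 :=
    hd2.hasFDerivAt.comp_hasDerivAt (0 : ℝ) (hinl 0 p₀)
  have h3 := h2.clm_comp (hasDerivAt_const (0 : ℝ) (ContinuousLinearMap.inr ℝ ℝ V))
  refine (h3.congr_of_eventuallyEq h1).congr_deriv ?_
  refine ContinuousLinearMap.ext fun a => ?_
  -- The time derivative of `Ψ` at `0` is `v`, so `Dv a` is the mixed second derivative taken first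
  -- in time, then in space. The derivative wanted has the other order, and second derivatives are
  -- symmetric.
  have h4 : (fun p => fderiv ℝ Ψ (0, p) (1, 0)) =ᶠ[𝓝 p₀] v := by
    filter_upwards [hv, hcp.eventually hdiff] with p hp hq
    exact (hq.hasFDerivAt.comp_hasDerivAt (0 : ℝ) (hinl 0 p)).unique hp
  have h5 : HasFDerivAt (fun p => fderiv ℝ Ψ (0, p))
      (fderiv ℝ (fderiv ℝ Ψ) (0, p₀) ∘L ContinuousLinearMap.inr ℝ ℝ V) p₀ :=
    hd2.hasFDerivAt.comp p₀ (hinr 0 p₀)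
  have h6 := (ContinuousLinearMap.apply ℝ V ((1 : ℝ), (0 : V))).hasFDerivAt.comp p₀ h5
  have h7 := congrArg (fun L => L a)
    (hd.hasFDerivAt.unique (h6.congr_of_eventuallyEq h4.symm))
  refine Eq.trans ?_ h7.symm
  simpa using hΨ.fderiv_fderiv_symm (1, 0) (0, a)

end Calculus

/-! ### Affine families in a chart, used in place of flows -/

section ChartFamily

variable {E E' M : Type*} [NormedAddCommGroup E] [NormedSpace ℝ E]
  [NormedAddCommGroup E'] [NormedSpace ℝ E'] [TopologicalSpace M] [ChartedSpace E M]

namespace OpenPartialHomeomorph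

/-- The affine family `x ↦ e⁻¹ (e x + t v (e x))` of local maps in a chart. -/
noncomputable def family (e : OpenPartialHomeomorph M E') (v : E' → E') (q : ℝ × M) : M :=
  e.symm (e q.2 + q.1 • v (e q.2))

/-- The domain of the affine family. -/
def familyDomain (e : OpenPartialHomeomorph M E') (v : E' → E') : Set (ℝ × M) :=
  {q | q.2 ∈ e.source ∧ e q.2 + q.1 • v (e q.2) ∈ e.target}

variable {e : OpenPartialHomeomorph M E'} {v : E' → E'}

lemma mem_familyDomain_zero {x : M} (hx : x ∈ e.source) : ((0 : ℝ), x) ∈ e.familyDomain v :=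
  ⟨hx, by simpa using e.map_source hx⟩

lemma family_zero {x : M} (hx : x ∈ e.source) : e.family v (0, x) = x := by
  simp [family, e.left_inv hx]

lemma contMDiffOn_familyAux (he : ContMDiffOn 𝓘(ℝ, E) 𝓘(ℝ, E') ∞ e e.source)
    (hv : ∀ p ∈ e.target, ContDiffAt ℝ ∞ v p) :
    ContMDiffOn (𝓘(ℝ, ℝ).prod 𝓘(ℝ, E)) 𝓘(ℝ, E') ∞
      (fun q : ℝ × M => e q.2 + q.1 • v (e q.2)) (Prod.snd ⁻¹' e.source) := by
  have h1 : ContMDiffOn (𝓘(ℝ, ℝ).prod 𝓘(ℝ, E)) 𝓘(ℝ, E') ∞ (fun q : ℝ × M => e q.2)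
      (Prod.snd ⁻¹' e.source) := he.comp contMDiff_snd.contMDiffOn fun _ hq => hq
  have h2 : ContMDiffOn (𝓘(ℝ, ℝ).prod 𝓘(ℝ, E)) 𝓘(ℝ, E') ∞ (fun q : ℝ × M => v (e q.2))
      (Prod.snd ⁻¹' e.source) := fun q hq =>
    (hv _ (e.map_source hq)).contMDiffAt.comp_contMDiffWithinAt q (h1 q hq)
  exact h1.add (contMDiff_fst.contMDiffOn.smul h2)

lemma isOpen_familyDomain (he : ContMDiffOn 𝓘(ℝ, E) 𝓘(ℝ, E') ∞ e e.source)
    (hv : ∀ p ∈ e.target, ContDiffAt ℝ ∞ v p) : IsOpen (e.familyDomain v) :=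
  (contMDiffOn_familyAux he hv).continuousOn.isOpen_inter_preimage
    (e.open_source.preimage continuous_snd) e.open_target

lemma contMDiffOn_family (he : ContMDiffOn 𝓘(ℝ, E) 𝓘(ℝ, E') ∞ e e.source)
    (he' : ContMDiffOn 𝓘(ℝ, E') 𝓘(ℝ, E) ∞ e.symm e.target)
    (hv : ∀ p ∈ e.target, ContDiffAt ℝ ∞ v p) :
    ContMDiffOn (𝓘(ℝ, ℝ).prod 𝓘(ℝ, E)) 𝓘(ℝ, E) ∞ (e.family v) (e.familyDomain v) :=
  he'.comp ((contMDiffOn_familyAux he hv).mono fun _ hq => hq.1) fun _ hq => hq.2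

/-- The affine motion has velocity `vecRep ξ` in the chart, and `e.symm` carries this back to `ξ x`.
Only the velocity at time `0` matters, so `ξ` need not be integrated. -/
lemma hasMFDerivAt_family (he : ContMDiffOn 𝓘(ℝ, E) 𝓘(ℝ, E') ∞ e e.source)
    (he' : ContMDiffOn 𝓘(ℝ, E') 𝓘(ℝ, E) ∞ e.symm e.target)
    (ξ : ∀ x : M, TangentSpace 𝓘(ℝ, E) x) {x : M} (hx : x ∈ e.source) :
    HasMFDerivAt 𝓘(ℝ, ℝ) 𝓘(ℝ, E) (fun t : ℝ => e.family (e.vecRep ξ) (t, x)) 0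
      ((1 : ℝ →L[ℝ] ℝ).smulRight (ξ (e.family (e.vecRep ξ) (0, x)))) := by
  have hM : e.MDifferentiable 𝓘(ℝ, E) 𝓘(ℝ, E') :=
    ⟨he.mdifferentiableOn (by simp), he'.mdifferentiableOn (by simp)⟩
  have h1 : HasDerivAt (fun t : ℝ => e x + t • e.vecRep ξ (e x)) (e.vecRep ξ (e x)) 0 := by
    simpa using ((hasDerivAt_id (0 : ℝ)).smul_const (e.vecRep ξ (e x))).const_add (e x)
  have h2 : HasMFDerivAt 𝓘(ℝ, E') 𝓘(ℝ, E) e.symm (e x + (0 : ℝ) • e.vecRep ξ (e x))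
      (mfderiv 𝓘(ℝ, E') 𝓘(ℝ, E) e.symm (e x + (0 : ℝ) • e.vecRep ξ (e x))) :=
    (hM.mdifferentiableAt_symm (by simpa using e.map_source hx)).hasMFDerivAt
  have h3 := h2.comp (0 : ℝ) h1.hasFDerivAt.hasMFDerivAt
  have key : ∀ a b : M, a = b → (ξ a : E) = ξ b := by rintro a _ rfl; rfl
  have h4 : (mfderiv 𝓘(ℝ, E') 𝓘(ℝ, E) e.symm (e x) (e.vecRep ξ (e x)) : E) = ξ x := by
    rw [e.vecRep_apply ξ hx]
    exact congrArg (fun L => L (ξ x)) (hM.symm_comp_deriv hx)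
  have h5 : (mfderiv 𝓘(ℝ, E') 𝓘(ℝ, E) e.symm (e x + (0 : ℝ) • e.vecRep ξ (e x)) :
      E' →L[ℝ] E) = mfderiv 𝓘(ℝ, E') 𝓘(ℝ, E) e.symm (e x) := by
    have : e x + (0 : ℝ) • e.vecRep ξ (e x) = e x := by simp
    rw [this]
  have h6 : ∀ s : ℝ, (mfderiv 𝓘(ℝ, E') 𝓘(ℝ, E) e.symm (e x + (0 : ℝ) • e.vecRep ξ (e x)) :
      E' →L[ℝ] E) (s • e.vecRep ξ (e x)) = s • (ξ x : E) := fun s => by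
    have h := (congrArg (fun L : E' →L[ℝ] E => L (s • e.vecRep ξ (e x))) h5)
    exact h.trans ((ContinuousLinearMap.map_smul
      (mfderiv 𝓘(ℝ, E') 𝓘(ℝ, E) e.symm (e x) : E' →L[ℝ] E) s _).trans (congrArg (s • ·) h4))
  have h7 : ∀ s : ℝ, s • (ξ x : E) = s • (ξ (e.family (e.vecRep ξ) (0, x)) : E) := fun s =>
    congrArg (s • ·) (key _ _ (family_zero hx)).symm
  exact h3.congr_mfderiv (ContinuousLinearMap.ext fun s => (h6 s).trans (h7 s))

end OpenPartialHomeomorph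

end ChartFamily

namespace SmoothFiberBundle

section Charts

variable {n k : ℕ} {X Y F : Type*}
  [TopologicalSpace X] [ChartedSpace (EuclideanSpace ℝ (Fin n)) X]
  [TopologicalSpace Y] [ChartedSpace (EuclideanSpace ℝ (Fin (n + k))) Y]
  [TopologicalSpace F] [ChartedSpace (EuclideanSpace ℝ (Fin k)) F]
  {B : SmoothFiberBundle n k X Y F}

variable [IsManifold (𝓡 n) ∞ X] [IsManifold (𝓡 (n + k)) ∞ Y]

/-- Around a point in the domain of an adapted chart there is a one-parameter family of local bundle
automorphisms generated by a projectable vector field. -/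
lemma AdaptedChart.exists_isLocalFamily (φ : B.AdaptedChart) (ξ : B.projectable) {y : Y}
    (hy : y ∈ φ.total.source) : ∃ ψ, B.IsLocalFamily ξ y ψ := by
  obtain ⟨ζ, hζ⟩ := ξ.2
  have hv := fun p (hp : p ∈ φ.total.target) => φ.contDiffAt_vecRep ξ.1 hp
  have hb := fun x (hx : x ∈ φ.base.target) => φ.contDiffAt_vecRep_base ζ hx
  refine ⟨φ.total.family (φ.total.vecRep ξ.1), φ.total.familyDomain (φ.total.vecRep ξ.1),
    φ.base.familyDomain (φ.base.vecRep ζ), φ.base.family (φ.base.vecRep ζ),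
    OpenPartialHomeomorph.isOpen_familyDomain φ.contMDiffOn hv,
    OpenPartialHomeomorph.isOpen_familyDomain φ.contMDiffOn_base hb,
    OpenPartialHomeomorph.mem_familyDomain_zero hy,
    OpenPartialHomeomorph.contMDiffOn_family φ.contMDiffOn φ.contMDiffOn_symm hv,
    OpenPartialHomeomorph.contMDiffOn_family φ.contMDiffOn_base φ.contMDiffOn_base_symm hb,
    ?_, fun y hy => OpenPartialHomeomorph.family_zero hy.1,
    fun y hy => OpenPartialHomeomorph.hasMFDerivAt_family φ.contMDiffOn φ.contMDiffOn_symm _ hy.1⟩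
  rintro t y ⟨hy, ht⟩
  -- By `vecRep_fst` the affine family on `Y` covers the affine family of `ζ` on `X`.
  have h1 : φ.base (B.proj y) + t • φ.base.vecRep ζ (φ.base (B.proj y)) =
      (φ.total y + t • φ.total.vecRep ξ.1 (φ.total y)).1 := by
    rw [φ.base_proj y hy, ← φ.vecRep_fst ξ.1 ζ hζ (φ.total.map_source hy)]
    rfl
  refine ⟨⟨φ.mapsTo y hy, ?_⟩, ?_⟩
  · change φ.base (B.proj y) + t • φ.base.vecRep ζ (φ.base (B.proj y)) ∈ φ.base.target
    rw [h1]
    exact φ.fst_mem_target ht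
  · exact (φ.proj_symm ht).trans (congrArg φ.base.symm h1.symm)

end Charts

end SmoothFiberBundle

/-! ### The lifted curve of a family and its velocity -/

namespace SmoothFiberBundle

section Charts

variable {n k : ℕ} {X Y F : Type*}
  [TopologicalSpace X] [ChartedSpace (EuclideanSpace ℝ (Fin n)) X]
  [TopologicalSpace Y] [ChartedSpace (EuclideanSpace ℝ (Fin (n + k))) Y]
  [TopologicalSpace F] [ChartedSpace (EuclideanSpace ℝ (Fin k)) F]
  {B : SmoothFiberBundle n k X Y F}

/-- This lets lifted curves built in different charts be identified. -/
lemma LVY.IsLift.unique {f : Y → Y} {w w₁ w₂ : B.LVY} (h₁ : w.IsLift f w₁) (h₂ : w.IsLift f w₂) :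
    w₁ = w₂ := by
  have h : ∀ u, w₁.vec u = w₂.vec u := fun u => (h₁ u).trans (h₂ u).symm
  obtain ⟨y₁, f₁, hf₁⟩ := w₁
  obtain ⟨y₂, f₂, hf₂⟩ := w₂
  obtain rfl : y₁ = y₂ := congrArg Bundle.TotalSpace.proj (h 0)
  have : f₁ = f₂ := ContinuousLinearEquiv.ext (funext fun u =>
    eq_of_heq (Bundle.TotalSpace.mk.inj (h u)).2)
  subst this
  rfl

namespace AdaptedChart

variable (φ : B.AdaptedChart)

/-- The coordinate representation of a time-dependent map of `Y`. -/
noncomputable def familyRep (ψ : ℝ × Y → Y) (q : ℝ × RSum n k) : RSum n k :=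
  φ.total (ψ (q.1, φ.total.symm q.2))

lemma totalSpace_ext {y y' : Y} (hy : y ∈ φ.total.source) (h : y = y')
    (z : TangentSpace (𝓡 (n + k)) y) (z' : TangentSpace (𝓡 (n + k)) y')
    (hz : (mfderiv (𝓡 (n + k)) 𝓘(ℝ, RSum n k) φ.total y z : RSum n k) =
      (mfderiv (𝓡 (n + k)) 𝓘(ℝ, RSum n k) φ.total y' z' : RSum n k)) :
    (⟨y, z⟩ : TangentBundle (𝓡 (n + k)) Y) = ⟨y', z'⟩ := by
  subst h
  exact congrArg _ ((φ.deriv hy).injective hz)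

variable [IsManifold (𝓡 n) ∞ X] [IsManifold (𝓡 (n + k)) ∞ Y]

/-- Supplies the input of `hasDerivAt_fderiv_of_family`, and the fact that for small `t` the spatial
derivative preserves vertical vectors, because `ψ_t` covers a map of `X`. -/
lemma familyRep_spec {ξ : B.projectable} {y₀ : Y} {ψ : ℝ × Y → Y} (hψ : B.IsLocalFamily ξ y₀ ψ)
    (hy₀ : y₀ ∈ φ.total.source) :
    ContDiffAt ℝ ∞ (φ.familyRep ψ) (0, φ.total y₀) ∧
    (∀ᶠ p in 𝓝 (φ.total y₀), φ.familyRep ψ (0, p) = p) ∧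
    (∀ᶠ p in 𝓝 (φ.total y₀),
      HasDerivAt (fun t => φ.familyRep ψ (t, p)) (φ.total.vecRep ξ.1 p) 0) ∧
    ∀ᶠ t in 𝓝 (0 : ℝ), ψ (t, y₀) ∈ φ.total.source ∧
      MDifferentiableAt (𝓡 (n + k)) (𝓡 (n + k)) (fun y => ψ (t, y)) y₀ ∧
      DifferentiableAt ℝ (fun p => φ.familyRep ψ (t, p)) (φ.total y₀) ∧
      ∀ u : RSum n k, u.1 = 0 →
        (fderiv ℝ (fun p => φ.familyRep ψ (t, p)) (φ.total y₀) u).1 = 0 := by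
  obtain ⟨O, O', ψ', hO, -, h0O, hsm, -, hproj, hid, hvel⟩ := hψ
  set p₀ := φ.total y₀ with hp₀
  have hp₀t : p₀ ∈ φ.total.target := φ.total.map_source hy₀
  have hsy : φ.total.symm p₀ = y₀ := φ.total.left_inv hy₀
  have hm : ∀ q : ℝ × RSum n k, q.2 ∈ φ.total.target →
      ContMDiffAt 𝓘(ℝ, ℝ × RSum n k) (𝓘(ℝ, ℝ).prod (𝓡 (n + k))) ∞
        (fun q : ℝ × RSum n k => (q.1, φ.total.symm q.2)) q := fun q hq =>
    contDiff_fst.contMDiff.contMDiffAt.prodMk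
      ((φ.contMDiffOn_symm.contMDiffAt (φ.total.open_target.mem_nhds hq)).comp q
        contDiff_snd.contMDiff.contMDiffAt)
  have hψm : ∀ q : ℝ × RSum n k, q.2 ∈ φ.total.target → (q.1, φ.total.symm q.2) ∈ O →
      ContMDiffAt 𝓘(ℝ, ℝ × RSum n k) (𝓡 (n + k)) ∞
        (fun q : ℝ × RSum n k => ψ (q.1, φ.total.symm q.2)) q := fun q hq hqO =>
    ContMDiffAt.comp q (hsm.contMDiffAt (hO.mem_nhds hqO)) (hm q hq)
  have hΨ : ∀ q : ℝ × RSum n k, q.2 ∈ φ.total.target → (q.1, φ.total.symm q.2) ∈ O →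
      ψ (q.1, φ.total.symm q.2) ∈ φ.total.source → ContDiffAt ℝ ∞ (φ.familyRep ψ) q :=
    fun q hq hqO hqs => contMDiffAt_iff_contDiffAt.1
      (ContMDiffAt.comp q (φ.contMDiffOn.contMDiffAt (φ.total.open_source.mem_nhds hqs))
        (hψm q hq hqO))
  have h0O' : ((0 : ℝ), φ.total.symm p₀) ∈ O := by rwa [hsy]
  have hψ0 : ψ (0, φ.total.symm p₀) ∈ φ.total.source := by rwa [hsy, hid y₀ h0O]
  have hS : ∀ᶠ q in 𝓝 ((0 : ℝ), p₀), q.2 ∈ φ.total.target ∧ (q.1, φ.total.symm q.2) ∈ O ∧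
      ψ (q.1, φ.total.symm q.2) ∈ φ.total.source := by
    refine Eventually.and ?_ (Eventually.and ?_ ?_)
    · exact continuous_snd.continuousAt.preimage_mem_nhds (φ.total.open_target.mem_nhds hp₀t)
    · exact (hm (0, p₀) hp₀t).continuousAt.preimage_mem_nhds (hO.mem_nhds h0O')
    · exact (hψm (0, p₀) hp₀t h0O').continuousAt.preimage_mem_nhds
        (φ.total.open_source.mem_nhds hψ0)
  have hct : Tendsto (fun t : ℝ => (t, p₀)) (𝓝 0) (𝓝 (0, p₀)) :=
    Continuous.tendsto (by fun_prop) 0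
  have hcp : ∀ (t : ℝ) (p : RSum n k), Tendsto (fun p : RSum n k => (t, p)) (𝓝 p) (𝓝 (t, p)) :=
    fun t p => Continuous.tendsto (by fun_prop) p
  refine ⟨hΨ _ hp₀t h0O' hψ0, ?_, ?_, ?_⟩
  · filter_upwards [(hcp 0 p₀).eventually hS] with p ⟨hp, hpO, hps⟩
    have h1 : ψ (0, φ.total.symm p) = φ.total.symm p := hid _ hpO
    exact (congrArg φ.total h1).trans (φ.total.right_inv hp)
  · filter_upwards [(hcp 0 p₀).eventually hS] with p ⟨hp, hpO, hps⟩
    have h1 : ψ (0, φ.total.symm p) = φ.total.symm p := hid _ hpO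
    have h2 := (φ.mdifferentiable.mdifferentiableAt hps).hasMFDerivAt.comp (0 : ℝ) (hvel _ hpO)
    have key : ∀ a b : Y, a = b →
        (mfderiv (𝓡 (n + k)) 𝓘(ℝ, RSum n k) φ.total a (ξ.1 a) : RSum n k) =
          mfderiv (𝓡 (n + k)) 𝓘(ℝ, RSum n k) φ.total b (ξ.1 b) := by
      rintro a _ rfl; rfl
    have h3 : ∀ s : ℝ, (mfderiv (𝓡 (n + k)) 𝓘(ℝ, RSum n k) φ.total (ψ (0, φ.total.symm p))
        (s • ξ.1 (ψ (0, φ.total.symm p))) : RSum n k) = s • φ.total.vecRep ξ.1 p := fun s =>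
      (ContinuousLinearMap.map_smul (mfderiv (𝓡 (n + k)) 𝓘(ℝ, RSum n k) φ.total
        (ψ (0, φ.total.symm p))) s _).trans (congrArg (s • ·) (key _ _ h1))
    have h4 : HasFDerivAt (fun t => φ.familyRep ψ (t, p))
        ((1 : ℝ →L[ℝ] ℝ).smulRight (φ.total.vecRep ξ.1 p)) (0 : ℝ) :=
      hasMFDerivAt_iff_hasFDerivAt.1 (h2.congr_mfderiv (ContinuousLinearMap.ext h3))
    simpa using h4.hasDerivAt
  · filter_upwards [hct.eventually hS.eventually_nhds] with t ht
    have ht0 := ht.self_of_nhds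
    have htp := (hcp t p₀).eventually ht
    have hd : DifferentiableAt ℝ (fun p => φ.familyRep ψ (t, p)) p₀ :=
      ((hΨ (t, p₀) ht0.1 ht0.2.1 ht0.2.2).differentiableAt (by simp)).comp p₀
        (differentiableAt_const t |>.prodMk differentiableAt_id)
    have hO1 : (t, y₀) ∈ O := by simpa only [hsy] using ht0.2.1
    refine ⟨by simpa only [hsy] using ht0.2.2, ?_, hd, fun u hu => ?_⟩
    · have h1 : ContMDiffAt (𝓡 (n + k)) (𝓘(ℝ, ℝ).prod (𝓡 (n + k))) ∞ (fun y : Y => (t, y)) y₀ :=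
        contMDiffAt_const.prodMk contMDiffAt_id
      exact (ContMDiffAt.comp y₀ (hsm.contMDiffAt (hO.mem_nhds hO1)) h1).mdifferentiableAt
        (by simp)
    -- The line `p₀ + s u` stays over one point of `X`, so the first components of its image under
    -- the family are constant for small `s`.
    · have hl : HasDerivAt (fun s : ℝ => p₀ + s • u) u 0 := by
        simpa using ((hasDerivAt_id (0 : ℝ)).smul_const u).const_add p₀
      have hd' : HasFDerivAt (fun p => φ.familyRep ψ (t, p))
          (fderiv ℝ (fun p => φ.familyRep ψ (t, p)) p₀) (p₀ + (0 : ℝ) • u) := by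
        simpa using hd.hasFDerivAt
      have h1 := (hasFDerivAt_fst (𝕜 := ℝ)).comp_hasDerivAt (0 : ℝ)
        (hd'.comp_hasDerivAt (0 : ℝ) hl)
      have hts : Tendsto (fun s : ℝ => p₀ + s • u) (𝓝 0) (𝓝 p₀) := by
        have := hl.continuousAt.tendsto
        simpa using this
      have h2 : (Prod.fst ∘ (fun p => φ.familyRep ψ (t, p)) ∘ fun s : ℝ => p₀ + s • u) =ᶠ[𝓝 0]
          fun _ => φ.base (ψ' (t, φ.base.symm p₀.1)) := by
        filter_upwards [hts.eventually htp] with s ⟨hs, hsO, hss⟩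
        have h3 := (hproj _ _ hsO).2
        change (φ.total (ψ (t, φ.total.symm (p₀ + s • u)))).1 = _
        rw [← φ.base_proj _ hss, h3, φ.proj_symm hs, Prod.fst_add, Prod.smul_fst, hu, smul_zero,
          add_zero]
      exact (h1.congr_of_eventuallyEq h2.symm).unique (hasDerivAt_const (0 : ℝ) _)

end AdaptedChart

end Charts

end SmoothFiberBundle

namespace SmoothFiberBundle

section Charts

variable {n k : ℕ} {X Y F : Type*}
  [TopologicalSpace X] [ChartedSpace (EuclideanSpace ℝ (Fin n)) X]
  [TopologicalSpace Y] [ChartedSpace (EuclideanSpace ℝ (Fin (n + k))) Y]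
  [TopologicalSpace F] [ChartedSpace (EuclideanSpace ℝ (Fin k)) F]
  {B : SmoothFiberBundle n k X Y F}

variable [IsManifold (𝓡 n) ∞ X] [IsManifold (𝓡 (n + k)) ∞ Y]

namespace AdaptedChart

variable (φ : B.AdaptedChart)

/-- The natural lift of a projectable vector field in the coordinates of the frame bundle. -/
noncomputable def liftRep (ξ : B.projectable) (q : FrameModel n k) : FrameModel n k :=
  (φ.total.vecRep ξ.1 q.1,
    BlockTri.ofCLM (fderiv ℝ (φ.total.vecRep ξ.1) q.1 ∘L q.2.toCLM))

lemma contDiffAt_liftRep (ξ : B.projectable) {q : FrameModel n k} (hq : q.1 ∈ φ.total.target) :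
    ContDiffAt ℝ ∞ (φ.liftRep ξ) q := by
  have hv := φ.contDiffAt_vecRep ξ.1 hq
  refine (hv.comp q contDiffAt_fst).prodMk (BlockTri.contDiff_ofCLM.contDiffAt.comp q ?_)
  exact ((hv.fderiv_right (m := ∞) (by simp)).comp q contDiffAt_fst).clm_comp
    (BlockTri.contDiff_toCLM.contDiffAt.comp q contDiffAt_snd)

/-- `BlockTri.ofCLM` discards the upper right block; projectability says that this block of `Dv W`
is zero. -/
lemma toCLM_liftRep (ξ : B.projectable) {w : B.LVY} (hw : w.base ∈ φ.total.source) :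
    (φ.liftRep ξ (φ.coord w)).2.toCLM =
      fderiv ℝ (φ.total.vecRep ξ.1) (φ.coord w).1 ∘L (φ.coord w).2.toCLM := by
  refine BlockTri.toCLM_ofCLM _ fun u hu => ?_
  refine φ.fderiv_vecRep_fst ξ (φ.total.map_source hw) ?_
  rw [φ.toCLM_coord w hw]
  exact (φ.matrix_fst w hw u).2 hu

variable [IsManifold (𝓡 k) ∞ F]

set_option synthInstance.maxHeartbeats 200000 in
/-- The lifted curve of a one-parameter family and its velocity, in an adapted chart. -/
lemma exists_lift_curve {ξ : B.projectable} {w : B.LVY} (hw : w.base ∈ φ.total.source)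
    {ψ : ℝ × Y → Y} (hψ : B.IsLocalFamily ξ w.base ψ) :
    ∃ c : ℝ → B.LVY, c 0 = w ∧ (∀ᶠ t in 𝓝 (0 : ℝ), w.IsLift (fun y => ψ (t, y)) (c t)) ∧
      HasMFDerivAt 𝓘(ℝ, ℝ) 𝓘(ℝ, FrameModel n k) c 0 ((1 : ℝ →L[ℝ] ℝ).smulRight
        ((φ.tcoord hw).symm (φ.liftRep ξ (φ.coord w)))) := by
  obtain ⟨hΨ, hid, hvel, hev⟩ := φ.familyRep_spec hψ hw
  set p₀ := φ.total w.base with hp₀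
  have hcw : (φ.coord w).1 = p₀ := rfl
  have hp₀t : p₀ ∈ φ.total.target := φ.total.map_source hw
  obtain ⟨hD0, hD⟩ := hasDerivAt_fderiv_of_family hΨ hid hvel
    ((φ.contDiffAt_vecRep ξ.1 hp₀t).differentiableAt (by simp))
  let W := (φ.coord w).2.toCLM
  -- The lifted curve in coordinates is `(Ψ_t(p₀), DΨ_t W)`, with velocity `(v, Dv W)` at `t = 0`.
  let q : ℝ → FrameModel n k := fun t => (φ.familyRep ψ (t, p₀),
    BlockTri.ofCLM (fderiv ℝ (fun p => φ.familyRep ψ (t, p)) p₀ ∘L W))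
  have hq0 : q 0 = φ.coord w := by
    refine Prod.ext hid.self_of_nhds ?_
    change BlockTri.ofCLM (fderiv ℝ (fun p => φ.familyRep ψ (0, p)) p₀ ∘L W) = _
    rw [hD0, ContinuousLinearMap.id_comp, BlockTri.ofCLM_toCLM]
  have hqd : HasDerivAt q (φ.liftRep ξ (φ.coord w)) 0 := by
    refine hvel.self_of_nhds.prodMk ?_
    exact (BlockTri.ofCLML n k).hasFDerivAt.comp_hasDerivAt (0 : ℝ)
      ((hD.clm_comp (hasDerivAt_const (0 : ℝ) W)).congr_deriv (by simp; rfl))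
  -- Invertibility of the diagonal blocks is an open condition, so it persists for small `t`; this
  -- replaces an assumption that `ψ_t` is a local diffeomorphism.
  have hqt : ∀ᶠ t in 𝓝 (0 : ℝ), q t ∈ (φ.frameHomeo w).target := by
    refine hqd.continuousAt.preimage_mem_nhds ((φ.frameHomeo w).open_target.mem_nhds ?_)
    rw [hq0]
    exact φ.mem_frameHomeo_target_coord (w := w) hw
  have hc0 : (φ.frameHomeo w).symm (q 0) = w := by
    rw [hq0]
    exact (φ.frameHomeo w).left_inv (x := w) hw
  refine ⟨fun t => (φ.frameHomeo w).symm (q t), hc0, ?_, ?_⟩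
  · filter_upwards [hqt, hev] with t htt ⟨hts, htd, htΨ, htv⟩ u
    have hb : ((φ.frameHomeo w).symm (q t)).base = ψ (t, w.base) := by
      refine (φ.frameHomeo_symm_base w htt).trans ?_
      change φ.total.symm (φ.total (ψ (t, φ.total.symm p₀))) = _
      rw [hp₀, φ.total.left_inv hw, φ.total.left_inv hts]
    have hs : ((φ.frameHomeo w).symm (q t)).base ∈ φ.total.source :=
      (φ.frameHomeo w).map_target htt
    refine φ.totalSpace_ext hs hb _ _ ?_
    have h1 : φ.coord ((φ.frameHomeo w).symm (q t)) = q t := (φ.frameHomeo w).right_inv htt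
    have h2 := φ.toCLM_coord _ hs
    rw [h1] at h2
    -- No block is lost in `q t`, since `DΨ_t` and `W` both preserve vertical vectors.
    have h3 : (q t).2.toCLM = fderiv ℝ (fun p => φ.familyRep ψ (t, p)) p₀ ∘L W := by
      refine BlockTri.toCLM_ofCLM _ fun u hu => htv _ ?_
      change ((φ.coord w).2.toCLM u).1 = 0
      rw [φ.toCLM_coord w hw]
      exact (φ.matrix_fst w hw u).2 hu
    have h4 : (mfderiv (𝓡 (n + k)) 𝓘(ℝ, RSum n k) φ.total ((φ.frameHomeo w).symm (q t)).base
        (((φ.frameHomeo w).symm (q t)).frame u) : RSum n k) =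
        fderiv ℝ (fun p => φ.familyRep ψ (t, p)) p₀ (W u) :=
      congrArg (fun L => L u) (h2.symm.trans h3)
    refine h4.trans ?_
    have h5 : W u = φ.deriv hw (w.frame u) := congrArg (fun L => L u) (φ.toCLM_coord w hw)
    rw [h5]
    have h6 := mfderiv_comp w.base (φ.mdifferentiable.mdifferentiableAt hts) htd
    have h7 := mfderiv_comp w.base htΨ.mdifferentiableAt (φ.mdifferentiable.mdifferentiableAt hw)
    rw [mfderiv_eq_fderiv] at h7
    have h8 : (fun p => φ.familyRep ψ (t, p)) ∘ φ.total =ᶠ[𝓝 w.base]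
        φ.total ∘ fun y => ψ (t, y) := by
      filter_upwards [φ.total.open_source.mem_nhds hw] with y hy
      change φ.total (ψ (t, φ.total.symm (φ.total y))) = φ.total (ψ (t, y))
      rw [φ.total.left_inv hy]
    exact congrArg (fun L => L (w.frame u)) (h7.symm.trans
      ((h8.mfderiv_eq (I := 𝓡 (n + k)) (I' := 𝓘(ℝ, RSum n k))).trans h6))
  · have h1 : HasMFDerivAt 𝓘(ℝ, FrameModel n k) 𝓘(ℝ, FrameModel n k) (φ.frameHomeo w).symm
        (q 0) (mfderiv 𝓘(ℝ, FrameModel n k) 𝓘(ℝ, FrameModel n k) (φ.frameHomeo w).symm (q 0)) :=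
      ((φ.mdifferentiable_frameHomeo w).mdifferentiableAt_symm hqt.self_of_nhds).hasMFDerivAt
    have h2 := h1.comp (0 : ℝ) hqd.hasFDerivAt.hasMFDerivAt
    have h3 : ∀ s : ℝ, (mfderiv 𝓘(ℝ, FrameModel n k) 𝓘(ℝ, FrameModel n k) (φ.frameHomeo w).symm
        (q 0) (s • φ.liftRep ξ (φ.coord w)) : FrameModel n k) =
        s • ((φ.tcoord hw).symm (φ.liftRep ξ (φ.coord w)) : FrameModel n k) := fun s => by
      have key : ∀ a b : FrameModel n k, a = b → ∀ z : FrameModel n k,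
          (mfderiv 𝓘(ℝ, FrameModel n k) 𝓘(ℝ, FrameModel n k) (φ.frameHomeo w).symm a z :
            FrameModel n k) = (mfderiv 𝓘(ℝ, FrameModel n k) 𝓘(ℝ, FrameModel n k)
              (φ.frameHomeo w).symm b z : FrameModel n k) := by
        rintro a _ rfl z; rfl
      exact (key _ _ hq0 _).trans ((φ.mfderiv_symm_coord hw _).trans
        ((φ.tcoord hw).symm.map_smul s _))
    exact h2.congr_mfderiv (ContinuousLinearMap.ext h3)

end AdaptedChart

end Charts

end SmoothFiberBundle

section Calculus

variable {E V V' : Type*} [NormedAddCommGroup E] [NormedSpace ℝ E]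
  [NormedAddCommGroup V] [NormedSpace ℝ V] [NormedAddCommGroup V'] [NormedSpace ℝ V']

/-- Differentiation of a solution `g` of `L g = h`. -/
lemma apply_fderiv_of_eventually_eq {L : E → V →L[ℝ] V'} {L' : E →L[ℝ] V →L[ℝ] V'}
    {g : E → V} {g' : E →L[ℝ] V} {h : E → V'} {h' : E →L[ℝ] V'} {x : E} (hL : HasFDerivAt L L' x)
    (hg : HasFDerivAt g g' x) (hh : HasFDerivAt h h' x) (hLg : ∀ᶠ q in 𝓝 x, L q (g q) = h q)
    (δ : E) : L x (g' δ) = h' δ - L' δ (g x) := by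
  have h4 : (fun q => L q (g q)) =ᶠ[𝓝 x] h := hLg
  have h5 := ((hL.clm_apply hg).congr_of_eventuallyEq h4.symm).unique hh
  have h6 := congrArg (fun L => L δ) h5
  exact eq_sub_of_add_eq h6

end Calculus

/-! ### The natural lift and the momentum mapping -/

namespace SmoothFiberBundle

section Charts

variable {n k : ℕ} {X Y F : Type*}
  [TopologicalSpace X] [ChartedSpace (EuclideanSpace ℝ (Fin n)) X]
  [TopologicalSpace Y] [ChartedSpace (EuclideanSpace ℝ (Fin (n + k))) Y]
  [TopologicalSpace F] [ChartedSpace (EuclideanSpace ℝ (Fin k)) F]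
  {B : SmoothFiberBundle n k X Y F}

namespace AdaptedChart

variable (φ : B.AdaptedChart)

lemma toCLM_coord_injective {w : B.LVY} (hw : w.base ∈ φ.total.source) {a b : RSum n k}
    (hab : (φ.coord w).2.toCLM a = (φ.coord w).2.toCLM b) : a = b := by
  rw [φ.toCLM_coord w hw] at hab
  exact (φ.matrix w hw).injective hab

/-- The two equations correspond under the isomorphism `dφ`. One direction identifies `Ĵ`, the other
puts an arbitrary tensorial function into coordinates. -/
lemma toCLM_coord_symm_frame (ξ : ∀ y : Y, TangentSpace (𝓡 (n + k)) y) {w : B.LVY}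
    (hw : w.base ∈ φ.total.source) {a : RSum n k} :
    (φ.coord w).2.toCLM a = φ.total.vecRep ξ (φ.coord w).1 ↔ w.frame a = ξ w.base := by
  have h1 : φ.total.vecRep ξ (φ.coord w).1 = φ.deriv hw (ξ w.base) := φ.total.vecRep_apply ξ hw
  rw [h1, φ.toCLM_coord w hw]
  exact (φ.deriv hw).injective.eq_iff

variable [IsManifold (𝓡 n) ∞ X] [IsManifold (𝓡 k) ∞ F]

/-- The derivative of a function on `L_V Y` which corresponds to a vector field on `Y`. -/
lemma mfderiv_of_toCLM_eq {f : B.LVY → RSum n k} {v : RSum n k → RSum n k} {w : B.LVY}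
    (hw : w.base ∈ φ.total.source) (hv : DifferentiableAt ℝ v (φ.coord w).1)
    (hf : ∀ᶠ w' in 𝓝 w, (φ.coord w').2.toCLM (f w') = v (φ.coord w').1)
    (u : TangentSpace 𝓘(ℝ, FrameModel n k) w) :
    (φ.coord w).2.toCLM (mfderiv 𝓘(ℝ, FrameModel n k) 𝓘(ℝ, RSum n k) f w u) =
      fderiv ℝ v (φ.coord w).1 (φ.tcoord hw u).1 - (φ.tcoord hw u).2.toCLM (f w) := by
  have hI := φ.inv_coord w hw
  -- In coordinates `f` is `W⁻¹ v(p)`; its derivative is obtained by differentiating `W g = v`.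
  let g : FrameModel n k → RSum n k := fun q => q.2.toCLM.inverse (v q.1)
  have hg1 : DifferentiableAt ℝ (fun q : FrameModel n k => q.2.toCLM.inverse) (φ.coord w) :=
    ((BlockTri.contDiffAt_inverse_toCLM hI).comp (φ.coord w) contDiffAt_snd).differentiableAt
      (by simp)
  have hv' : HasFDerivAt (fun q : FrameModel n k => v q.1)
      (fderiv ℝ v (φ.coord w).1 ∘L ContinuousLinearMap.fst ℝ _ _) (φ.coord w) :=
    hv.hasFDerivAt.comp (φ.coord w) hasFDerivAt_fst
  have hg : DifferentiableAt ℝ g (φ.coord w) := hg1.clm_apply hv'.differentiableAt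
  have hLg : ∀ᶠ q in 𝓝 (φ.coord w), q.2.toCLM (g q) = v q.1 := by
    filter_upwards [(BlockTri.isOpen_setOf_inv.preimage continuous_snd).mem_nhds hI] with q hq
    exact (BlockTri.Inv.isInvertible hq).self_apply_inverse _
  have hfg : f =ᶠ[𝓝 w] fun w' => g (φ.coord w') := by
    filter_upwards [hf, φ.eventually_base_mem hw] with w' h1 hw'
    exact ((φ.inv_coord w' hw').isInvertible.inverse_apply_eq.2 h1.symm).symm
  have h1 : (mfderiv 𝓘(ℝ, FrameModel n k) 𝓘(ℝ, RSum n k) f w u : RSum n k) =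
      fderiv ℝ g (φ.coord w) (φ.tcoord hw u) :=
    (congrArg (fun L => L u)
      (hfg.mfderiv_eq (I := 𝓘(ℝ, FrameModel n k)) (I' := 𝓘(ℝ, RSum n k)))).trans
      (φ.mfderiv_comp_coord hw hg.hasFDerivAt u)
  have h2 := apply_fderiv_of_eventually_eq (L := fun q : FrameModel n k => q.2.toCLM)
    (BlockTri.toCLML n k ∘L ContinuousLinearMap.snd ℝ (RSum n k) _).hasFDerivAt
    hg.hasFDerivAt hv' hLg (φ.tcoord hw u)
  refine (congrArg (φ.coord w).2.toCLM h1).trans (h2.trans ?_)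
  rw [hfg.self_of_nhds]
  rfl

lemma contMDiffAt_of_toCLM_eq {f : B.LVY → RSum n k} {v : RSum n k → RSum n k} {w : B.LVY}
    (hw : w.base ∈ φ.total.source) (hv : ContDiffAt ℝ ∞ v (φ.coord w).1)
    (hf : ∀ᶠ w' in 𝓝 w, (φ.coord w').2.toCLM (f w') = v (φ.coord w').1) :
    ContMDiffAt 𝓘(ℝ, FrameModel n k) 𝓘(ℝ, RSum n k) ∞ f w := by
  have hI := φ.inv_coord w hw
  have hg : ContDiffAt ℝ ∞ (fun q : FrameModel n k => q.2.toCLM.inverse (v q.1)) (φ.coord w) :=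
    ((BlockTri.contDiffAt_inverse_toCLM hI).comp (φ.coord w) contDiffAt_snd).clm_apply
      (hv.comp (φ.coord w) contDiffAt_fst)
  refine (hg.contMDiffAt.comp w ((φ.contMDiffOn_frameHomeo w).contMDiffAt
    ((φ.frameHomeo w).open_source.mem_nhds hw))).congr_of_eventuallyEq ?_
  filter_upwards [hf, φ.eventually_base_mem hw] with w' h1 hw'
  exact ((φ.inv_coord w' hw').isInvertible.inverse_apply_eq.2 h1.symm).symm

end AdaptedChart

variable [IsManifold (𝓡 n) ∞ X] [IsManifold (𝓡 k) ∞ F]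

lemma hasMFDerivAt_smulRight_unique {c c' : ℝ → B.LVY} {z : TangentSpace 𝓘(ℝ, FrameModel n k) (c 0)}
    {z' : TangentSpace 𝓘(ℝ, FrameModel n k) (c' 0)} (h : c =ᶠ[𝓝 0] c')
    (hc : HasMFDerivAt 𝓘(ℝ, ℝ) 𝓘(ℝ, FrameModel n k) c 0 ((1 : ℝ →L[ℝ] ℝ).smulRight z))
    (hc' : HasMFDerivAt 𝓘(ℝ, ℝ) 𝓘(ℝ, FrameModel n k) c' 0 ((1 : ℝ →L[ℝ] ℝ).smulRight z')) :
    (z : FrameModel n k) = z' := by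
  have h1 := hasMFDerivAt_unique hc (hc'.congr_of_eventuallyEq h)
  have h2 : ((1 : ℝ) • z : FrameModel n k) = ((1 : ℝ) • z' : FrameModel n k) :=
    congrArg (fun L => L (1 : ℝ)) h1
  exact (one_smul ℝ (z : FrameModel n k)).symm.trans (h2.trans (one_smul ℝ (z' : FrameModel n k)))

variable [IsManifold (𝓡 (n + k)) ∞ Y]

/-- Both sides are velocities of lifts of the same family `ψ`, computed in different charts, and the
two lifted curves coincide near `0`. This replaces a direct check with the transition formulas. -/
lemma AdaptedChart.tcoord_symm_liftRep (φ φ' : B.AdaptedChart) (ξ : B.projectable) {w : B.LVY}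
    (hw : w.base ∈ φ.total.source) (hw' : w.base ∈ φ'.total.source) :
    (φ.tcoord hw).symm (φ.liftRep ξ (φ.coord w)) =
      (φ'.tcoord hw').symm (φ'.liftRep ξ (φ'.coord w)) := by
  obtain ⟨ψ, hψ⟩ := φ.exists_isLocalFamily ξ hw
  obtain ⟨c, -, hl, hd⟩ := φ.exists_lift_curve hw hψ
  obtain ⟨c', -, hl', hd'⟩ := φ'.exists_lift_curve hw' hψ
  exact hasMFDerivAt_smulRight_unique
    (by filter_upwards [hl, hl'] with t h h' using h.unique h') hd hd'

/-- The value of the natural lift, computed in the preferred adapted chart. -/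
noncomputable def liftVec (ξ : B.projectable) (w : B.LVY) :
    TangentSpace 𝓘(ℝ, FrameModel n k) w :=
  ((B.adaptedChartAt w.base).tcoord (B.mem_adaptedChartAt w.base)).symm
    ((B.adaptedChartAt w.base).liftRep ξ ((B.adaptedChartAt w.base).coord w))

lemma AdaptedChart.tcoord_liftVec (φ : B.AdaptedChart) (ξ : B.projectable) {w : B.LVY}
    (hw : w.base ∈ φ.total.source) : φ.tcoord hw (liftVec ξ w) = φ.liftRep ξ (φ.coord w) := by
  rw [liftVec, ← φ.tcoord_symm_liftRep _ ξ hw, ContinuousLinearEquiv.apply_symm_apply]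

set_option synthInstance.maxHeartbeats 200000 in
lemma contMDiff_liftVec (ξ : B.projectable) :
    ContMDiff 𝓘(ℝ, FrameModel n k) (𝓘(ℝ, FrameModel n k).prod 𝓘(ℝ, FrameModel n k)) ∞
      (fun w : B.LVY => (Bundle.TotalSpace.mk' (FrameModel n k) w (liftVec ξ w) :
        TangentBundle 𝓘(ℝ, FrameModel n k) B.LVY)) := by
  intro w
  let φ := B.adaptedChartAt w.base
  have hw : w.base ∈ φ.total.source := B.mem_adaptedChartAt w.base
  refine (contMDiffAt_section_iff_chart (φ.frameHomeo w) (φ.contMDiffOn_frameHomeo w)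
    (φ.contMDiffOn_frameHomeo_symm w) _ hw).2 ?_
  have hq := φ.mem_frameHomeo_target_coord (w₀ := w) hw
  refine (φ.contDiffAt_liftRep ξ hq.1).congr_of_eventuallyEq ?_
  filter_upwards [(φ.frameHomeo w).open_target.mem_nhds hq] with q hq
  have h1 := φ.tcoord_liftVec ξ ((φ.frameHomeo w).map_target hq)
  rw [show φ.coord ((φ.frameHomeo w).symm q) = q from (φ.frameHomeo w).right_inv hq] at h1
  exact h1

/-- The natural lift of a projectable vector field. -/
noncomputable def liftField (ξ : B.projectable) : SmoothVectorField (FrameModel n k) B.LVY :=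
  ⟨liftVec ξ, contMDiff_liftVec ξ⟩

lemma isNaturalLift_liftField (ξ : B.projectable) : B.IsNaturalLift ξ (liftField ξ) where
  exists_family w := (B.adaptedChartAt w.base).exists_isLocalFamily ξ (B.mem_adaptedChartAt w.base)
  velocity w ψ hψ := by
    obtain ⟨c, h0, hl, hd⟩ :=
      (B.adaptedChartAt w.base).exists_lift_curve (B.mem_adaptedChartAt w.base) hψ
    refine ⟨c, h0, hl, ?_⟩
    subst h0
    exact hd

/-- Each value is the velocity of a lifted curve. The existence clause of `IsNaturalLift` is
essential: without a family at `w` the velocity clause would say nothing there. -/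
lemma IsNaturalLift.unique {ξ : B.projectable} {Ξ Ξ' : SmoothVectorField (FrameModel n k) B.LVY}
    (h : B.IsNaturalLift ξ Ξ) (h' : B.IsNaturalLift ξ Ξ') : Ξ = Ξ' := by
  refine ContMDiffSection.ext fun w => ?_
  obtain ⟨ψ, hψ⟩ := h.exists_family w
  obtain ⟨c, h0, hl, hd⟩ := h.velocity w ψ hψ
  obtain ⟨c', h0', hl', hd'⟩ := h'.velocity w ψ hψ
  have h1 := hasMFDerivAt_smulRight_unique
    (by filter_upwards [hl, hl'] with t h h' using h.unique h') hd hd'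
  have key : ∀ (Ξ : SmoothVectorField (FrameModel n k) B.LVY) (a b : B.LVY), a = b →
      (Ξ a : FrameModel n k) = Ξ b := by
    rintro Ξ a _ rfl; rfl
  exact (key Ξ _ _ h0).symm.trans (h1.trans (key Ξ' _ _ h0'))

/-- By uniqueness the arbitrary choice in `naturalLift` is the field computed in charts. -/
lemma naturalLift_eq (ξ : B.projectable) : B.naturalLift ξ = liftField ξ :=
  (Classical.epsilon_spec ⟨_, isNaturalLift_liftField ξ⟩ :
    B.IsNaturalLift ξ (B.naturalLift ξ)).unique (isNaturalLift_liftField ξ)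

lemma AdaptedChart.tcoord_naturalLift (φ : B.AdaptedChart) (ξ : B.projectable) {w : B.LVY}
    (hw : w.base ∈ φ.total.source) :
    φ.tcoord hw (B.naturalLift ξ w) = φ.liftRep ξ (φ.coord w) := by
  rw [naturalLift_eq]
  exact φ.tcoord_liftVec ξ hw

lemma AdaptedChart.toCLM_Jhat (φ : B.AdaptedChart) (ξ : B.projectable) {w : B.LVY}
    (hw : w.base ∈ φ.total.source) :
    (φ.coord w).2.toCLM (B.Jhat ξ w) = φ.total.vecRep ξ.1 (φ.coord w).1 := by
  rw [Jhat, φ.toCLM_soldering hw, φ.tcoord_naturalLift ξ hw]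
  rfl

lemma frame_Jhat (ξ : B.projectable) (w : B.LVY) : w.frame (B.Jhat ξ w) = ξ.1 w.base :=
  ((B.adaptedChartAt w.base).toCLM_coord_symm_frame ξ.1 (B.mem_adaptedChartAt w.base)).1
    ((B.adaptedChartAt w.base).toCLM_Jhat ξ (B.mem_adaptedChartAt w.base))

/-- `Ĵ(ξ)(w)` is the vector of components of `ξ` in the frame `w`. -/
lemma Jhat_eq (ξ : B.projectable) (w : B.LVY) : B.Jhat ξ w = w.frame.symm (ξ.1 w.base) :=
  (w.frame.symm_apply_eq.2 (frame_Jhat ξ w).symm).symm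

lemma contMDiff_Jhat (ξ : B.projectable) :
    ContMDiff 𝓘(ℝ, FrameModel n k) 𝓘(ℝ, RSum n k) ∞ (B.Jhat ξ) := by
  intro w
  have hw := B.mem_adaptedChartAt w.base
  refine (B.adaptedChartAt w.base).contMDiffAt_of_toCLM_eq hw
    ((B.adaptedChartAt w.base).contDiffAt_vecRep ξ.1
      ((B.adaptedChartAt w.base).total.map_source hw)) ?_
  filter_upwards [(B.adaptedChartAt w.base).eventually_base_mem hw] with w' hw'
  exact (B.adaptedChartAt w.base).toCLM_Jhat ξ hw'

/-- With `f = Ĵ(ξ) = θ(Ξ)` and `δW_Ξ = Dv W`, one has `-W dθ(Ξ, u) = Dv W θ(u) - δW_u f = Dv δp_u -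
δW_u f`, which is `W df(u)`. Since `W` is injective, the equation follows. -/
lemma isHamiltonianPair_Jhat (ξ : B.projectable) :
    B.IsHamiltonianPair (B.Jhat ξ) (B.naturalLift ξ) := by
  intro w u
  obtain ⟨φ, hw⟩ : ∃ φ : B.AdaptedChart, w.base ∈ φ.total.source :=
    ⟨_, B.mem_adaptedChartAt w.base⟩
  have hp : (φ.coord w).1 ∈ φ.total.target := φ.total.map_source hw
  have h1 := φ.mfderiv_of_toCLM_eq hw
    ((φ.contDiffAt_vecRep ξ.1 hp).differentiableAt (by simp))
    (by filter_upwards [φ.eventually_base_mem hw] with w' hw' using φ.toCLM_Jhat ξ hw') u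
  have h2 := φ.toCLM_structureForm hw (B.naturalLift ξ w) u
  have h3 : (φ.tcoord hw (B.naturalLift ξ w)).2.toCLM (B.soldering w u) =
      fderiv ℝ (φ.total.vecRep ξ.1) (φ.coord w).1 (φ.tcoord hw u).1 := by
    rw [φ.tcoord_naturalLift ξ hw, φ.toCLM_liftRep ξ hw, ContinuousLinearMap.comp_apply,
      φ.toCLM_soldering hw u]
  refine φ.toCLM_coord_injective hw (h1.trans ?_)
  rw [map_neg, h2, h3, neg_sub]
  rfl

lemma Jhat_mem_T1V (ξ : B.projectable) : B.Jhat ξ ∈ B.T1V := by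
  refine ⟨⟨contMDiff_Jhat ξ, _, isHamiltonianPair_Jhat ξ⟩, contMDiff_Jhat ξ, fun w N K A => ?_⟩
  rw [Jhat_eq, Jhat_eq]
  rfl

/-- The momentum mapping `⟨J(w), ξ⟩ = Ĵ(ξ)(w)`. -/
noncomputable def momentum (w : B.LVY) : B.projectable →ₗ[ℝ] RSum n k where
  toFun ξ := B.Jhat ξ w
  map_add' ξ ξ' := by
    rw [Jhat_eq, Jhat_eq, Jhat_eq]
    exact map_add w.frame.symm _ _
  map_smul' c ξ := by
    rw [Jhat_eq, Jhat_eq]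
    exact map_smul w.frame.symm _ _

lemma isMomentumMapping_momentum : B.IsMomentumMapping momentum where
  contMDiff_lift η := η.contMDiff_lift
  invariant η w u v := η.structureForm_lift w u v
  contMDiff ξ := contMDiff_Jhat ξ
  hamiltonian ξ := isHamiltonianPair_Jhat ξ

/-- Both sides are `w⁻¹ (dη)⁻¹ ξ(η y)`, with `y` the base point of `w`. -/
lemma isAdEquivariant_momentum : B.IsAdEquivariant momentum := by
  intro η ξ w
  change B.Jhat (η.inv.Ad ξ) w = B.Jhat ξ (η.lift w)
  rw [Jhat_eq, Jhat_eq]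
  have h : (mfderiv (𝓡 (n + k)) (𝓡 (n + k)) η.toDiffeo w.base).inverse =
      ((η.toDiffeo.mfderivToContinuousLinearEquiv (by simp) w.base).symm :
        TangentSpace (𝓡 (n + k)) (η.toDiffeo w.base) →L[ℝ] TangentSpace (𝓡 (n + k)) w.base) :=
    ContinuousLinearMap.inverse_equiv (η.toDiffeo.mfderivToContinuousLinearEquiv (by simp) w.base)
  exact congrArg (fun L => w.frame.symm (L (ξ.1 (η.toDiffeo w.base)))) h

end Charts

end SmoothFiberBundle

/-! ### The converse: from tensorial Hamiltonian observables to projectable fields -/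

namespace SmoothFiberBundle

section Charts

variable {n k : ℕ} {X Y F : Type*}
  [TopologicalSpace X] [ChartedSpace (EuclideanSpace ℝ (Fin n)) X]
  [TopologicalSpace Y] [ChartedSpace (EuclideanSpace ℝ (Fin (n + k))) Y]
  [TopologicalSpace F] [ChartedSpace (EuclideanSpace ℝ (Fin k)) F]
  {B : SmoothFiberBundle n k X Y F}

/-- The group acts transitively on adapted frames at a point: `g = w⁻¹ w'` preserves `0 × ℝᵏ`, so it
is block triangular with invertible diagonal blocks. -/
lemma LVY.exists_act {w w' : B.LVY} (h : w.base = w'.base) :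
    ∃ (N : EuclideanSpace ℝ (Fin n) ≃L[ℝ] EuclideanSpace ℝ (Fin n))
      (K : EuclideanSpace ℝ (Fin k) ≃L[ℝ] EuclideanSpace ℝ (Fin k))
      (A : EuclideanSpace ℝ (Fin n) →L[ℝ] EuclideanSpace ℝ (Fin k)), w' = w.act N K A := by
  obtain ⟨y, f, hf⟩ := w
  obtain ⟨y', f', hf'⟩ := w'
  obtain rfl : y = y' := h
  let g : RSum n k ≃L[ℝ] RSum n k := f'.trans f.symm
  have hfg : ∀ u, f (g u) = f' u := fun u => f.apply_symm_apply _
  have hg : ∀ u, (g u).1 = 0 ↔ u.1 = 0 := fun u => by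
    rw [← hf, hfg]
    exact hf' u
  have hI : (BlockTri.ofCLM (g : RSum n k →L[ℝ] RSum n k)).Inv :=
    BlockTri.inv_ofCLM _ (fun u hu => g.map_eq_zero_iff.1 hu) hg
  have hge : ∀ u, hI.equiv u = g u := fun u => by
    rw [hI.equiv_apply, BlockTri.toCLM_ofCLM _ fun u hu => (hg u).2 hu]
    rfl
  refine ⟨hI.1.choose, hI.2.choose, (BlockTri.ofCLM (g : RSum n k →L[ℝ] RSum n k)).2.2, ?_⟩
  have key : ∀ f₁ f₂ : RSum n k ≃L[ℝ] TangentSpace (𝓡 (n + k)) y, f₁ = f₂ → ∀ h₁ h₂,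
      (⟨y, f₁, h₁⟩ : B.LVY) = ⟨y, f₂, h₂⟩ := by
    rintro f₁ _ rfl _ _; rfl
  have hf'' : f' = hI.equiv.trans f := ContinuousLinearEquiv.ext (funext fun u =>
    (hfg u).symm.trans (congrArg f (hge u).symm))
  exact key _ _ hf'' _ _

namespace AdaptedChart

variable (φ : B.AdaptedChart)

/-- The coordinate frame over a point of an adapted chart. -/
noncomputable def coordFrame {p : RSum n k} (hp : p ∈ φ.total.target) : B.LVY :=
  φ.frameOf (p, BlockTri.ofCLM (ContinuousLinearMap.id ℝ _)) hp BlockTri.inv_ofCLM_id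

lemma coordFrame_base_mem {p : RSum n k} (hp : p ∈ φ.total.target) :
    (φ.coordFrame hp).base ∈ φ.total.source := φ.total.map_target hp

lemma coord_coordFrame {p : RSum n k} (hp : p ∈ φ.total.target) :
    φ.coord (φ.coordFrame hp) = (p, BlockTri.ofCLM (ContinuousLinearMap.id ℝ _)) :=
  φ.coord_frameOf _ _ _

lemma toCLM_coordFrame {p : RSum n k} (hp : p ∈ φ.total.target) :
    (φ.coord (φ.coordFrame hp)).2.toCLM = ContinuousLinearMap.id ℝ _ := by
  rw [φ.coord_coordFrame]
  exact BlockTri.toCLM_ofCLM _ fun _ h => h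

/-- In an adapted chart, the projection of the vector field is locally constant along the fibers. -/
lemma exists_ball_vecRep_fst_eq {ξ : ∀ y : Y, TangentSpace (𝓡 (n + k)) y}
    (hs : ∀ p ∈ φ.total.target, ContDiffAt ℝ ∞ (φ.total.vecRep ξ) p)
    (h : ∀ p ∈ φ.total.target, ∀ a : RSum n k, a.1 = 0 → (fderiv ℝ (φ.total.vecRep ξ) p a).1 = 0)
    {p : RSum n k} (hp : p ∈ φ.total.target) :
    ∀ᶠ p' in 𝓝 p, p'.1 = p.1 → (φ.total.vecRep ξ p').1 = (φ.total.vecRep ξ p).1 := by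
  -- In the product metric a ball is a product of balls, so its vertical slice is a ball in `ℝᵏ`.
  -- Being connected, it allows a vanishing derivative to give constancy.
  obtain ⟨r, hr, hb⟩ := Metric.isOpen_iff.1 φ.total.open_target p hp
  filter_upwards [Metric.ball_mem_nhds p hr] with p' hp' he
  have hmem : ∀ z ∈ Metric.ball p.2 r, (p.1, z) ∈ φ.total.target := fun z hz => hb <| by
    rw [← ball_prod_same]
    exact ⟨Metric.mem_ball_self hr, hz⟩
  have hd : ∀ z ∈ Metric.ball p.2 r, HasFDerivAt (fun z => (φ.total.vecRep ξ (p.1, z)).1)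
      (0 : EuclideanSpace ℝ (Fin k) →L[ℝ] EuclideanSpace ℝ (Fin n)) z := fun z hz => by
    have h1 := ((hs _ (hmem z hz)).differentiableAt (by simp)).hasFDerivAt.comp z
      (hasFDerivAt_prodMk_right p.1 z)
    refine (hasFDerivAt_fst.comp z h1).congr_fderiv (ContinuousLinearMap.ext fun a => ?_)
    exact h _ (hmem z hz) (0, a) rfl
  have h2 := Metric.isOpen_ball.is_const_of_fderiv_eq_zero (𝕜 := ℝ)
    (convex_ball p.2 r).isPreconnected
    (fun z hz => (hd z hz).differentiableAt.differentiableWithinAt)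
    (fun z hz => (hd z hz).fderiv) (x := p'.2) (y := p.2)
    (by rw [← ball_prod_same] at hp'; exact hp'.2) (Metric.mem_ball_self hr)
  rw [show p' = (p.1, p'.2) from Prod.ext he rfl]
  exact h2

end AdaptedChart

/-- The projection to `X` of a vector field on `Y`, as a vector of the model space. -/
noncomputable def projVec (B : SmoothFiberBundle n k X Y F)
    (ξ : ∀ y : Y, TangentSpace (𝓡 (n + k)) y) (y : Y) : EuclideanSpace ℝ (Fin n) :=
  mfderiv (𝓡 (n + k)) (𝓡 n) B.proj y (ξ y)

/-- A trivialization identifies the fiber with `F`, where the projected vector becomes a locally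
constant function. This is where connectedness is needed. -/
lemma projVec_eq_of_proj_eq [PreconnectedSpace F] {ξ : ∀ y : Y, TangentSpace (𝓡 (n + k)) y}
    (h : ∀ y, ∀ᶠ y' in 𝓝 y, B.proj y' = B.proj y → B.projVec ξ y' = B.projVec ξ y)
    {y y' : Y} (hy : B.proj y = B.proj y') : B.projVec ξ y = B.projVec ξ y' := by
  obtain ⟨e, he, -, -⟩ := B.exists_trivialization (B.proj y)
  have ht : ∀ z : F, (B.proj y, z) ∈ e.target := fun z => e.mem_target.2 he
  have hpr : ∀ z : F, B.proj (e.toOpenPartialHomeomorph.symm (B.proj y, z)) = B.proj y :=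
    fun z => e.proj_symm_apply (ht z)
  have hc : IsLocallyConstant
      fun z : F => B.projVec ξ (e.toOpenPartialHomeomorph.symm (B.proj y, z)) := by
    refine IsLocallyConstant.iff_eventually_eq _ |>.2 fun z => ?_
    have h1 : ContinuousAt (fun z : F => e.toOpenPartialHomeomorph.symm (B.proj y, z)) z :=
      (e.toOpenPartialHomeomorph.continuousAt_symm (ht z)).comp (by fun_prop)
    filter_upwards [h1.tendsto.eventually (h _)] with z' hz'
    exact hz' ((hpr z').trans (hpr z).symm)
  have h2 : ∀ y₁ : Y, B.proj y₁ = B.proj y →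
      e.toOpenPartialHomeomorph.symm (B.proj y, (e y₁).2) = y₁ := fun y₁ hy₁ => by
    have hs : y₁ ∈ e.source := e.mem_source.2 (by rwa [hy₁])
    have h3 : (B.proj y, (e y₁).2) = e y₁ := Prod.ext ((e.coe_fst hs).trans hy₁).symm rfl
    rw [h3]
    exact e.toOpenPartialHomeomorph.left_inv hs
  have h3 := hc.apply_eq_of_preconnectedSpace (e y).2 (e y').2
  simpa only [h2 y rfl, h2 y' hy.symm] using h3

lemma exists_proj_eq (B : SmoothFiberBundle n k X Y F) [Nonempty F] (x : X) :
    ∃ y, B.proj y = x := by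
  obtain ⟨e, he, -, -⟩ := B.exists_trivialization x
  exact ⟨e.toOpenPartialHomeomorph.symm (x, Classical.arbitrary F),
    e.proj_symm_apply (e.mem_target.2 he)⟩

variable [IsManifold (𝓡 n) ∞ X] [IsManifold (𝓡 k) ∞ F]

lemma LVY.exists_base_eq (y : Y) : ∃ w : B.LVY, w.base = y :=
  ⟨(B.adaptedChartAt y).frameOf ((B.adaptedChartAt y).total y,
      BlockTri.ofCLM (ContinuousLinearMap.id ℝ _))
    ((B.adaptedChartAt y).total.map_source (B.mem_adaptedChartAt y)) BlockTri.inv_ofCLM_id,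
    (B.adaptedChartAt y).total.left_inv (B.mem_adaptedChartAt y)⟩

/-- If `w' = w g`, then `w' (f w') = w g (g⁻¹ f(w)) = w (f w)`. -/
lemma frame_apply_eq_of_mem_T1 {f : B.LVY → RSum n k} (hf : f ∈ B.T1) {w w' : B.LVY}
    (h : w.base = w'.base) :
    (w.frame (f w) : EuclideanSpace ℝ (Fin (n + k))) = w'.frame (f w') := by
  obtain ⟨N, K, A, rfl⟩ := LVY.exists_act h
  rw [hf.2]
  exact congrArg w.frame ((N.skewProd K A).apply_symm_apply (f w)).symm

/-- A tensorial function is given by a vector field on `Y`. -/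
lemma exists_frame_eq_of_mem_T1 {f : B.LVY → RSum n k} (hf : f ∈ B.T1) :
    ∃ ξ : ∀ y : Y, TangentSpace (𝓡 (n + k)) y, ∀ w : B.LVY, w.frame (f w) = ξ w.base := by
  choose s hs using LVY.exists_base_eq (B := B)
  exact ⟨fun y => ((s y).frame (f (s y)) : EuclideanSpace ℝ (Fin (n + k))),
    fun w => frame_apply_eq_of_mem_T1 hf (hs w.base).symm⟩

namespace AdaptedChart

variable (φ : B.AdaptedChart)

/-- Along the coordinate frames `p ↦ (p, 1)` the function `f` is itself the representative of `ξ`,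
so smoothness passes from `f` to `ξ`. -/
lemma contDiffAt_vecRep_of_frame {f : B.LVY → RSum n k}
    (hf : ContMDiff 𝓘(ℝ, FrameModel n k) 𝓘(ℝ, RSum n k) ∞ f)
    {ξ : ∀ y : Y, TangentSpace (𝓡 (n + k)) y} (h : ∀ w : B.LVY, w.frame (f w) = ξ w.base)
    {p : RSum n k} (hp : p ∈ φ.total.target) : ContDiffAt ℝ ∞ (φ.total.vecRep ξ) p := by
  let w₀ := φ.coordFrame hp
  let b : BlockTri n k := BlockTri.ofCLM (ContinuousLinearMap.id ℝ _)
  have hq : (p, b) ∈ (φ.frameHomeo w₀).target := ⟨hp, BlockTri.inv_ofCLM_id⟩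
  have h1 : ContMDiffAt 𝓘(ℝ, FrameModel n k) 𝓘(ℝ, RSum n k) ∞
      (fun q => f ((φ.frameHomeo w₀).symm q)) (p, b) :=
    ContMDiffAt.comp (p, b) (hf _) ((φ.contMDiffOn_frameHomeo_symm w₀).contMDiffAt
      ((φ.frameHomeo w₀).open_target.mem_nhds hq))
  have h1' : ContDiffAt ℝ ∞ (fun q => f ((φ.frameHomeo w₀).symm q)) (p, b) :=
    contMDiffAt_iff_contDiffAt.1 h1
  have hpb : ContDiffAt ℝ ∞ (fun p : RSum n k => (p, b)) p := contDiffAt_id.prodMk contDiffAt_const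
  have h2 := h1'.comp p hpb
  refine h2.congr_of_eventuallyEq ?_
  filter_upwards [φ.total.open_target.mem_nhds hp] with p' hp'
  have hq' : (p', b) ∈ (φ.frameHomeo w₀).target := ⟨hp', BlockTri.inv_ofCLM_id⟩
  have hs := (φ.frameHomeo w₀).map_target hq'
  have h3 := (φ.toCLM_coord_symm_frame ξ hs).2 (h _)
  rw [show φ.coord ((φ.frameHomeo w₀).symm (p', b)) = (p', b) from
    (φ.frameHomeo w₀).right_inv hq'] at h3
  have h4 : b.toCLM = ContinuousLinearMap.id ℝ _ := BlockTri.toCLM_ofCLM _ fun _ h => h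
  exact (h3.symm.trans (congrArg (fun L : RSum n k →L[ℝ] RSum n k =>
    L (f ((φ.frameHomeo w₀).symm (p', b)))) h4))

/-- The vector field of a Hamiltonian function has projectable derivatives. -/
lemma fderiv_vecRep_fst_of_hamiltonian {f : B.LVY → RSum n k}
    (hf : ContMDiff 𝓘(ℝ, FrameModel n k) 𝓘(ℝ, RSum n k) ∞ f)
    {Z : SmoothVectorField (FrameModel n k) B.LVY} (hZ : B.IsHamiltonianPair f Z)
    {ξ : ∀ y : Y, TangentSpace (𝓡 (n + k)) y} (h : ∀ w : B.LVY, w.frame (f w) = ξ w.base)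
    {p : RSum n k} (hp : p ∈ φ.total.target) {a : RSum n k} (ha : a.1 = 0) :
    (fderiv ℝ (φ.total.vecRep ξ) p a).1 = 0 := by
  -- The Hamilton equation is evaluated at the coordinate frame, on the vector `u` that moves the
  -- base point along `a` and keeps the matrix fixed.
  let w := φ.coordFrame hp
  have hw : w.base ∈ φ.total.source := φ.coordFrame_base_mem hp
  have hp' : (φ.coord w).1 = p := congrArg Prod.fst (φ.coord_coordFrame hp)
  have hid : (φ.coord w).2.toCLM = ContinuousLinearMap.id ℝ _ := φ.toCLM_coordFrame hp
  let u := (φ.tcoord hw).symm (a, 0)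
  have hu : φ.tcoord hw u = (a, 0) := (φ.tcoord hw).apply_symm_apply _
  have hv := (φ.contDiffAt_vecRep_of_frame hf h hp).differentiableAt (by simp)
  rw [← hp'] at hv
  have h1 := φ.mfderiv_of_toCLM_eq hw hv (by
    filter_upwards [φ.eventually_base_mem hw] with w' hw'
    exact (φ.toCLM_coord_symm_frame ξ hw').2 (h w')) u
  have h2 := φ.toCLM_structureForm hw (Z w) u
  have h3 := φ.toCLM_soldering hw u
  have h0 : ∀ z : RSum n k, (0 : BlockTri n k).toCLM z = 0 := fun z =>
    congrArg (fun L => L z) (map_zero (BlockTri.toCLML n k))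
  have h4 := congrArg (φ.coord w).2.toCLM (hZ w u)
  rw [hu] at h1 h2 h3
  rw [hid] at h3
  have h3' : B.soldering w u = a := h3
  -- Nothing is known about `Z` except that it is tangent to `L_V Y`; its matrix part is therefore
  -- block triangular and maps the vertical `a` to a vertical vector.
  have h5 : fderiv ℝ (φ.total.vecRep ξ) p a = (φ.tcoord hw (Z w)).2.toCLM a := by
    rw [h0, hp', sub_zero] at h1
    rw [h0, zero_sub, h3'] at h2
    refine h1.symm.trans (h4.trans ?_)
    rw [map_neg, h2, neg_neg]
  rw [h5, BlockTri.toCLM_apply]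
  simp [ha]

end AdaptedChart

/-- Transfers `exists_ball_vecRep_fst_eq` from coordinates to `X`: over a common point of `X` the
differential of the base chart is injective. -/
lemma eventually_projVec_eq {ξ : ∀ y : Y, TangentSpace (𝓡 (n + k)) y}
    (hs : ∀ φ : B.AdaptedChart, ∀ p ∈ φ.total.target, ContDiffAt ℝ ∞ (φ.total.vecRep ξ) p)
    (h : ∀ φ : B.AdaptedChart, ∀ p ∈ φ.total.target, ∀ a : RSum n k, a.1 = 0 →
      (fderiv ℝ (φ.total.vecRep ξ) p a).1 = 0) (y : Y) :
    ∀ᶠ y' in 𝓝 y, B.proj y' = B.proj y → B.projVec ξ y' = B.projVec ξ y := by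
  obtain ⟨φ, hy⟩ : ∃ φ : B.AdaptedChart, y ∈ φ.total.source := ⟨_, B.mem_adaptedChartAt y⟩
  have h1 := (φ.total.continuousAt hy).tendsto.eventually
    (φ.exists_ball_vecRep_fst_eq (hs φ) (h φ) (φ.total.map_source hy))
  filter_upwards [h1, φ.total.open_source.mem_nhds hy] with y' hy1 hy' hpr
  have h2 : ∀ z ∈ φ.total.source, (φ.total.vecRep ξ (φ.total z)).1 =
      (mfderiv (𝓡 n) (𝓡 n) φ.base (B.proj z) (B.projVec ξ z) : EuclideanSpace ℝ (Fin n)) :=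
    fun z hz => (congrArg Prod.fst (φ.total.vecRep_apply ξ hz)).trans (φ.deriv_fst hz (ξ z))
  have h3 := hy1 (by rw [← φ.base_proj y' hy', ← φ.base_proj y hy, hpr])
  rw [h2 y' hy', h2 y hy] at h3
  have key : ∀ a b : X, a = b → ∀ z : EuclideanSpace ℝ (Fin n),
      (mfderiv (𝓡 n) (𝓡 n) φ.base a z : EuclideanSpace ℝ (Fin n)) =
        (mfderiv (𝓡 n) (𝓡 n) φ.base b z : EuclideanSpace ℝ (Fin n)) := by
    rintro a _ rfl z; rfl
  exact φ.mdifferentiable_base.mfderiv_injective (φ.mapsTo y hy)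
    ((key _ _ hpr _).symm.trans h3)

/-- A vector field on `Y` whose projection depends only on the point of `X` is related to a smooth
vector field on `X`. -/
lemma exists_proj_related [Nonempty F] {ξ : ∀ y : Y, TangentSpace (𝓡 (n + k)) y}
    (hs : ∀ φ : B.AdaptedChart, ∀ p ∈ φ.total.target, ContDiffAt ℝ ∞ (φ.total.vecRep ξ) p)
    (h : ∀ y y', B.proj y = B.proj y' → B.projVec ξ y = B.projVec ξ y') :
    ∃ ζ : SmoothVectorField (EuclideanSpace ℝ (Fin n)) X,
      ∀ y, mfderiv (𝓡 (n + k)) (𝓡 n) B.proj y (ξ y) = ζ (B.proj y) := by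
  -- The section `s` need not be continuous. It only defines values, and another choice gives the
  -- same ones by `h`.
  choose s hsec using B.exists_proj_eq
  let ζ : ∀ x : X, TangentSpace (𝓡 n) x := fun x => B.projVec ξ (s x)
  have hζ : ∀ y, mfderiv (𝓡 (n + k)) (𝓡 n) B.proj y (ξ y) = ζ (B.proj y) := fun y =>
    h y (s (B.proj y)) (hsec _).symm
  refine ⟨⟨ζ, fun x => ?_⟩, hζ⟩
  obtain ⟨φ, hy⟩ : ∃ φ : B.AdaptedChart, s x ∈ φ.total.source := ⟨_, B.mem_adaptedChartAt (s x)⟩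
  have hx : x ∈ φ.base.source := by
    have := φ.mapsTo _ hy
    rwa [hsec] at this
  refine (contMDiffAt_section_iff_chart φ.base φ.contMDiffOn_base φ.contMDiffOn_base_symm ζ
    hx).2 ?_
  have hp := φ.total.map_source hy
  have hbx : φ.base x = (φ.total (s x)).1 := by rw [← φ.base_proj _ hy, hsec]
  -- Smoothness at `x` is read along the slice of constant fiber coordinate through `s x`, a smooth
  -- local section, where `ζ` is the first component of `ξ`.
  have h1 : ContDiffAt ℝ ∞ (fun q : EuclideanSpace ℝ (Fin n) => (q, (φ.total (s x)).2))
      (φ.base x) := contDiffAt_id.prodMk contDiffAt_const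
  have hpe : (φ.base x, (φ.total (s x)).2) = φ.total (s x) := Prod.ext hbx rfl
  have hp' : (φ.base x, (φ.total (s x)).2) ∈ φ.total.target := by rwa [hpe]
  have h2 := ((hs φ _ hp').comp (φ.base x) h1).fst
  refine h2.congr_of_eventuallyEq ?_
  filter_upwards [h1.continuousAt.preimage_mem_nhds (φ.total.open_target.mem_nhds hp')] with q hq
  exact (φ.vecRep_fst ξ ζ hζ hq).symm

variable [IsManifold (𝓡 (n + k)) ∞ Y]

/-- If the fibers are connected, every tensorial Hamiltonian observable comes from a projectable
vector field. -/
lemma exists_Jhat_eq [PreconnectedSpace F] {f : B.LVY → RSum n k} (hf : f ∈ B.T1V) :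
    ∃ ξ : B.projectable, B.Jhat ξ = f := by
  -- `PreconnectedSpace` allows `F` to be empty; then there are no frames, and the zero field works.
  rcases isEmpty_or_nonempty F with hF | hF
  · refine ⟨0, funext fun w => ?_⟩
    obtain ⟨e, -, -, -⟩ := B.exists_trivialization (B.proj w.base)
    exact hF.elim (e w.base).2
  obtain ⟨⟨hsm, Z, hZ⟩, hT⟩ := hf
  obtain ⟨ξ, hξ⟩ := exists_frame_eq_of_mem_T1 hT
  have hs : ∀ φ : B.AdaptedChart, ∀ p ∈ φ.total.target, ContDiffAt ℝ ∞ (φ.total.vecRep ξ) p :=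
    fun φ p hp => φ.contDiffAt_vecRep_of_frame hsm hξ hp
  have hev := eventually_projVec_eq hs fun φ p hp a ha =>
    φ.fderiv_vecRep_fst_of_hamiltonian hsm hZ hξ hp ha
  obtain ⟨ζ, hζ⟩ := exists_proj_related hs fun y y' hy => projVec_eq_of_proj_eq hev hy
  have hsec : ContMDiff (𝓡 (n + k)) ((𝓡 (n + k)).prod 𝓘(ℝ, EuclideanSpace ℝ (Fin (n + k)))) ∞
      (fun y => (Bundle.TotalSpace.mk' (EuclideanSpace ℝ (Fin (n + k))) y (ξ y) :
        TangentBundle (𝓡 (n + k)) Y)) := fun y => by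
    have hy := B.mem_adaptedChartAt y
    exact (contMDiffAt_section_iff_chart _ (B.adaptedChartAt y).contMDiffOn
      (B.adaptedChartAt y).contMDiffOn_symm ξ hy).2
      (hs _ _ ((B.adaptedChartAt y).total.map_source hy))
  refine ⟨⟨⟨ξ, hsec⟩, ζ, hζ⟩, funext fun w => ?_⟩
  rw [Jhat_eq]
  exact w.frame.symm_apply_eq.2 (hξ w).symm

end Charts

end SmoothFiberBundle

theorem lemma3p3 {n k : ℕ} {X Y F : Type*}
    [TopologicalSpace X] [ChartedSpace (EuclideanSpace ℝ (Fin n)) X] [IsManifold (𝓡 n) ∞ X]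
    [TopologicalSpace Y] [ChartedSpace (EuclideanSpace ℝ (Fin (n + k))) Y]
    [IsManifold (𝓡 (n + k)) ∞ Y]
    [TopologicalSpace F] [ChartedSpace (EuclideanSpace ℝ (Fin k)) F] [IsManifold (𝓡 k) ∞ F]
    (B : SmoothFiberBundle n k X Y F) :
    -- every projectable vector field has a unique natural lift to `L_V Y`
    (∀ ξ : B.projectable, ∃! Ξ : SmoothVectorField (FrameModel n k) B.LVY,
      B.IsNaturalLift ξ Ξ) ∧
    -- `Ĵ ξ = ξ_{L_V Y} ⌟ i^*θ` is a tensorial Hamiltonian observable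
    (∀ ξ : B.projectable, B.Jhat ξ ∈ B.T1V) ∧
    -- `Ĵ` comes from a momentum mapping, which is `Ad^*`-equivariant
    (∃ J : B.LVY → (B.projectable →ₗ[ℝ] RSum n k),
      (∀ (ξ : B.projectable) (w : B.LVY), J w ξ = B.Jhat ξ w) ∧
      B.IsMomentumMapping J ∧ B.IsAdEquivariant J) ∧
    -- if the fibers are connected, every tensorial Hamiltonian observable is of this form
    (PreconnectedSpace F → ∀ f ∈ B.T1V, ∃ ξ : B.projectable, B.Jhat ξ = f) :=
  ⟨fun ξ => ⟨SmoothFiberBundle.liftField ξ, SmoothFiberBundle.isNaturalLift_liftField ξ,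
      fun _ h => h.unique (SmoothFiberBundle.isNaturalLift_liftField ξ)⟩,
    fun ξ => SmoothFiberBundle.Jhat_mem_T1V ξ,
    ⟨SmoothFiberBundle.momentum, fun _ _ => rfl, SmoothFiberBundle.isMomentumMapping_momentum,
      SmoothFiberBundle.isAdEquivariant_momentum⟩,
    fun _ _ hf => SmoothFiberBundle.exists_Jhat_eq hf⟩
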